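/- Let $X$ be a smooth, projective, irreducible curve over $\mathbb{C}$ with function field $K(X)$, let $E$ and $F$ be vector bundles over $X$ of ranks $m$ and $n$, with sheaves of sections $\mathcal{E}$ and $\mathcal{F}$, and let $0 \to E \xrightarrow{i} W \xrightarrow{\pi} F \to 0$ be an extension with class $\delta(W) \in H^1(X, \mathrm{Hom}(F,E))$. For a vector bundle $V$ let $\mathrm{Rat}(V)$ be the space of rational sections of $V$ and $\underline{\mathrm{Prin}}(V) = \underline{\mathrm{Rat}}(V)/\mathcal{V}$ the sheaf of principal parts; write $\mathrm{Prin}(V)$ for its global sections, and $[q] \in H^1(X,V)$ for the image of $q \in \mathrm{Prin}(V)$ under the connecting map. A principal part $q \in \mathrm{Prin}(\mathrm{Hom}(F,E))$ defines a map of sheaves $q : \mathcal{F} \to \underline{\mathrm{Prin}}(E)$. An elementary transformation of $F$ is a locally free subsheaf $\mathcal{K} \subseteq \mathcal{F}$ of rank $n$ with $\mathcal{F}/\mathcal{K}$ supported at finitely many points; a lifting of it to a rank $n$ subbundle of $W$ is a map $j : \mathcal{K} \to \mathcal{W}$ such that $\pi \circ j$ is the inclusion $\mathcal{K} \subseteq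 \mathcal{F}$ and $j$ identifies $\mathcal{K}$ with the sheaf of sections of a vector subbundle of rank $n$ of $W$. Suppose that $h^0(X, \mathrm{Hom}(F,E)) = 0$. Then there is a bijection between the principal parts $q \in \mathrm{Prin}(\mathrm{Hom}(F,E))$ with $[q] = \delta(W)$ and the elementary transformations $\mathcal{K}$ of $F$ given together with a lifting $j$ to a rank $n$ subbundle of $W$, such that if $q$ corresponds to $(\mathcal{K}, j)$ then $\mathcal{K} = \mathrm{Ker}(q : \mathcal{F} \to \underline{\mathrm{Prin}}(E))$, and $j$ is the restriction to $\mathcal{K}$ of a $K(X)$-linear map $s : \mathrm{Rat}(F) \to \mathrm{Rat}(W)$ such that, at every point $x$ and for every $b \in \mathrm{Hom}_{K(X)}(\mathrm{Rat}(F), \mathrm{Rat}(E))$ whose principal part at $x$ is that of $q$, the map $s + i \circ b$ is regular at $x$. -/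

import Mathlib

open CategoryTheory CategoryTheory.Limits AlgebraicGeometry TopologicalSpace

noncomputable section

namespace CurveExt

variable {X : Scheme.{0}}

/-! ### Vector bundles and subbundles -/

/-- The restriction map of sections of an `𝒪_X`-module along `V ≤ U`. -/
abbrev resSec (M : X.Modules) {U V : X.Opens} (h : V ≤ U) : Γ(M, U) →+ Γ(M, V) :=
  (M.presheaf.map (homOfLE h).op).hom

/-- `M` is locally free of rank `n`: near every point there is a local frame, i.e. `n` sections
over an open `U` whose restrictions to every open `V ≤ U` form an `𝒪_X(V)`-basis of `M(V)`
(equivalently, they define an isomorphism `𝒪_U ^ n ≅ M|_U`). -/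
def IsLocallyFreeOfRank (M : X.Modules) (n : ℕ) : Prop :=
  ∀ x : X, ∃ U : X.Opens, x ∈ U ∧ ∃ e : Fin n → Γ(M, U), ∀ (V : X.Opens) (h : V ≤ U),
    LinearIndependent Γ(X, V) (fun k => resSec M h (e k)) ∧
      Submodule.span Γ(X, V) (Set.range fun k => resSec M h (e k)) = ⊤

/-- `j : G ⟶ W` is the inclusion of a vector subbundle of rank `n`: it is a monomorphism of sheaves,
`G` is locally free of rank `n`, and the quotient `W / G` is locally free. -/
def IsSubbundle {G W : X.Modules} (j : G ⟶ W) (n : ℕ) : Prop :=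
  Mono j ∧ IsLocallyFreeOfRank G n ∧ ∃ r : ℕ, IsLocallyFreeOfRank (cokernel j) r

/-- An elementary transformation of a bundle `F` of rank `n`: a locally free subsheaf `K ⊆ F` of the
same rank, such that `F / K` is supported at finitely many points, i.e. `K_x ⟶ F_x` is surjective
for all but finitely many `x`. -/
def IsElementaryTransformation {F : X.Modules} (n : ℕ) (K : Subobject F) : Prop :=
  IsLocallyFreeOfRank (K : X.Modules) n ∧
    {x : X | ¬ Function.Surjective ((TopCat.Presheaf.stalkFunctor Ab x).map
      K.arrow.mapPresheaf).hom}.Finite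

/-! ### The sheaf `Hom(F, E)` -/

/-- The group of sections over `U` of the sheaf `Hom(F, E)`: morphisms `F|_U ⟶ E|_U`, i.e. families
of `𝒪_X(V)`-linear maps `F(V) → E(V)`, for `V ≤ U`, compatible with restriction. -/
def HomSections (F E : X.Modules) (U : X.Opens) :
    AddSubgroup (∀ V : {V : X.Opens // V ≤ U}, Γ(F, V.1) →ₗ[Γ(X, V.1)] Γ(E, V.1)) where
  carrier := {φ | ∀ (V V' : {V : X.Opens // V ≤ U}) (h : V'.1 ≤ V.1) (f : Γ(F, V.1)),
    resSec E h (φ V f) = φ V' (resSec F h f)}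
  add_mem' := by
    intro φ ψ hφ hψ V V' h f
    simp only [Pi.add_apply, LinearMap.add_apply, map_add, hφ V V' h f, hψ V V' h f]
  zero_mem' := by
    intro V V' h f
    simp
  neg_mem' := by
    intro φ hφ V V' h f
    simp only [Pi.neg_apply, LinearMap.neg_apply, map_neg, hφ V V' h f]

/-- Restriction of sections of `Hom(F, E)`. -/
def HomSections.res {F E : X.Modules} {U V : X.Opens} (h : V ≤ U) :
    HomSections F E U →+ HomSections F E V where
  toFun φ := ⟨fun V' => φ.1 ⟨V'.1, V'.2.trans h⟩,
    fun V₁ V₂ h' f => φ.2 ⟨V₁.1, V₁.2.trans h⟩ ⟨V₂.1, V₂.2.trans h⟩ h' f⟩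
  map_zero' := rfl
  map_add' _ _ := rfl

/-! ### Rational sections and principal parts -/

section Rational

variable [IsIntegral X]

/-- The generic point lies in every open set that has a point. -/
theorem genericPoint_mem {x : X} {U : X.Opens} (h : x ∈ U) : genericPoint X ∈ U :=
  (genericPoint_specializes x).mem_open U.isOpen h

/-- `Rat(M)`: the group of rational sections of `M`, i.e. the stalk at the generic point. -/
abbrev RatSec (M : X.Modules) : Type := M.presheaf.stalk (genericPoint X)

/-- `Rat(M)` is a vector space over the function field `K(X)`. -/
instance instModuleRatSec (M : X.Modules) : Module X.functionField (RatSec M) :=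
  let N : PresheafOfModules (X.presheaf ⋙ forget₂ CommRingCat RingCat) := M.val
  inferInstanceAs (Module (X.presheaf.stalk (genericPoint X))
    (TopCat.Presheaf.stalk (C := Ab) N.presheaf (genericPoint X)))

theorem toRat_germ_smul (M : X.Modules) (U : X.Opens) (h : genericPoint X ∈ U) (r : Γ(X, U)) (m : Γ(M, U)) :
    M.presheaf.germ U (genericPoint X) h (r • m) =
      (X.presheaf.germ U (genericPoint X) h r : X.functionField) •
        (M.presheaf.germ U (genericPoint X) h m : RatSec M) :=
  PresheafOfModules.germ_smul (R := X.presheaf) M.val _ U h r m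

/-- The rational section defined by a section over a nonempty open set. -/
abbrev toRat (M : X.Modules) {U : X.Opens} (h : genericPoint X ∈ U) : Γ(M, U) →+ RatSec M :=
  (M.presheaf.germ U (genericPoint X) h).hom

/-- The map `Rat(M) → Rat(N)` induced by a morphism `M ⟶ N`. -/
abbrev ratMap {M N : X.Modules} (φ : M ⟶ N) : RatSec M →+ RatSec N :=
  ((TopCat.Presheaf.stalkFunctor Ab (genericPoint X)).map φ.mapPresheaf).hom

/-- The rational sections of `M` that are regular at `x`: those that come from a section over a
neighbourhood of `x` (i.e. the image of the stalk `M_x` in `Rat(M)`). -/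
def regularAt (M : X.Modules) (x : X) : AddSubgroup (RatSec M) where
  carrier := {s | ∃ (U : X.Opens) (hx : x ∈ U) (m : Γ(M, U)), toRat M (genericPoint_mem hx) m = s}
  add_mem' := by
    rintro _ _ ⟨U, hU, m, rfl⟩ ⟨V, hV, m', rfl⟩
    refine ⟨U ⊓ V, ⟨hU, hV⟩, resSec M inf_le_left m + resSec M inf_le_right m', ?_⟩
    rw [map_add]
    congr 1
    · exact TopCat.Presheaf.germ_res_apply' _ _ _ _ _
    · exact TopCat.Presheaf.germ_res_apply' _ _ _ _ _
  zero_mem' := ⟨⊤, trivial, 0, map_zero _⟩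
  neg_mem' := by
    rintro _ ⟨U, hU, m, rfl⟩
    exact ⟨U, hU, -m, map_neg _ _⟩

theorem toRat_mem_regularAt {M : X.Modules} {x : X} {U : X.Opens} (hx : x ∈ U) (m : Γ(M, U)) :
    toRat M (genericPoint_mem hx) m ∈ regularAt M x :=
  ⟨U, hx, m, rfl⟩

/-- `Rat(Hom(F, E)) = Hom_{K(X)}(Rat(F), Rat(E))`: the rational sections of `Hom(F, E)`. -/
abbrev RatHom (F E : X.Modules) : Type := RatSec F →ₗ[X.functionField] RatSec E

/-- The section `φ` of `Hom(F, E)` over `U` is the restriction to `U` of the rational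
section `β`. -/
def Induces {F E : X.Modules} {U : X.Opens} (φ : HomSections F E U) (β : RatHom F E) : Prop :=
  ∀ (V : {V : X.Opens // V ≤ U}) (h : genericPoint X ∈ V.1) (f : Γ(F, V.1)),
    toRat E h (φ.1 V f) = β (toRat F h f)

/-- The rational sections of `Hom(F, E)` that are regular at `x`: those that come from a section of
the sheaf `Hom(F, E)` over a neighbourhood of `x`. -/
def homRegularAt (F E : X.Modules) (x : X) : AddSubgroup (RatHom F E) where
  carrier := {β | ∃ U : X.Opens, x ∈ U ∧ ∃ φ : HomSections F E U, Induces φ β}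
  add_mem' := by
    rintro β β' ⟨U, hU, φ, hφ⟩ ⟨V, hV, ψ, hψ⟩
    refine ⟨U ⊓ V, ⟨hU, hV⟩, HomSections.res inf_le_left φ + HomSections.res inf_le_right ψ, ?_⟩
    intro W h f
    rw [LinearMap.add_apply, ← hφ ⟨W.1, W.2.trans inf_le_left⟩ h f,
      ← hψ ⟨W.1, W.2.trans inf_le_right⟩ h f, ← map_add]
    rfl
  zero_mem' := ⟨⊤, trivial, 0, fun V h f => map_zero (toRat E h)⟩
  neg_mem' := by
    rintro β ⟨U, hU, φ, hφ⟩
    refine ⟨U, hU, -φ, fun V h f => ?_⟩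
    rw [LinearMap.neg_apply, ← hφ V h f, ← map_neg]
    rfl

/-- Let `R` be a group of rational sections and `A x ≤ R` the subgroup of those that are regular
at `x`. The sections over `U` of the sheaf of principal parts, i.e. of the quotient of the constant
sheaf `R` by the subsheaf of regular sections: families of elements of the stalks `R / A x`,
`x ∈ U`, that are locally the principal parts of a single rational section. -/
def principalParts {R : Type} [AddCommGroup R] (A : X → AddSubgroup R) (U : X.Opens) :
    AddSubgroup (∀ x : U, R ⧸ A x.1) where
  carrier := {p | ∀ x : U, ∃ V : X.Opens, x.1 ∈ V ∧ ∃ r : R, ∀ y : U, y.1 ∈ V →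
    p y = QuotientAddGroup.mk r}
  add_mem' := by
    intro p q hp hq x
    obtain ⟨V, hV, r, hr⟩ := hp x
    obtain ⟨V', hV', r', hr'⟩ := hq x
    refine ⟨V ⊓ V', ⟨hV, hV'⟩, r + r', fun y hy => ?_⟩
    rw [Pi.add_apply, hr y hy.1, hr' y hy.2]
    rfl
  zero_mem' := fun x => ⟨⊤, trivial, 0, fun _ _ => rfl⟩
  neg_mem' := by
    intro p hp x
    obtain ⟨V, hV, r, hr⟩ := hp x
    refine ⟨V, hV, -r, fun y hy => ?_⟩
    rw [Pi.neg_apply, hr y hy]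
    rfl

/-- The sections over `U` of the sheaf `Prin(E)` of principal parts with values in `E`. -/
abbrev Prin (E : X.Modules) (U : X.Opens) : AddSubgroup (∀ x : U, RatSec E ⧸ regularAt E x.1) :=
  principalParts (regularAt E) U

/-- `Prin(Hom(F, E))`: the group of (global) principal parts with values in `Hom(F, E)`. -/
abbrev PrinHom (F E : X.Modules) :
    AddSubgroup (∀ x : (⊤ : X.Opens), RatHom F E ⧸ homRegularAt F E x.1) :=
  principalParts (homRegularAt F E) ⊤

/-- Evaluation at a section of `F` that is regular at `x`, on stalks at `x` of the sheaves of
principal parts: `β mod Hom(F, E)_x ↦ β(f) mod E_x`. -/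
def evalStalk (F E : X.Modules) (x : X) (f : RatSec F) (hf : f ∈ regularAt F x) :
    RatHom F E ⧸ homRegularAt F E x →+ RatSec E ⧸ regularAt E x :=
  QuotientAddGroup.map (homRegularAt F E x) (regularAt E x)
    { toFun := fun β => β f
      map_zero' := LinearMap.zero_apply f
      map_add' := fun β β' => LinearMap.add_apply β β' f } (by
    rintro β ⟨U, hU, φ, hφ⟩
    obtain ⟨V, hV, m, rfl⟩ := hf
    refine ⟨U ⊓ V, ⟨hU, hV⟩, φ.1 ⟨U ⊓ V, inf_le_left⟩ (resSec F inf_le_right m), ?_⟩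
    rw [hφ ⟨U ⊓ V, inf_le_left⟩ (genericPoint_mem (x := x) ⟨hU, hV⟩)]
    exact congrArg β (TopCat.Presheaf.germ_res_apply' _ _ _ _ _))

/-- The map of sheaves `q : F ⟶ Prin(E)` defined by `q ∈ Prin(Hom(F, E))`, on sections over `U`. -/
def PrinHom.app {F E : X.Modules} (q : PrinHom F E) (U : X.Opens) : Γ(F, U) →+ Prin E U where
  toFun f := ⟨fun x => evalStalk F E x.1 (toRat F (genericPoint_mem x.2) f) (toRat_mem_regularAt x.2 f)
      (q.1 ⟨x.1, trivial⟩), by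
    intro x
    obtain ⟨V, hV, β, hβ⟩ := q.2 ⟨x.1, trivial⟩
    refine ⟨V, hV, β (toRat F (genericPoint_mem x.2) f), fun y hy => ?_⟩
    exact congrArg (evalStalk F E y.1 _ (toRat_mem_regularAt y.2 f)) (hβ ⟨y.1, trivial⟩ hy)⟩
  map_zero' := by
    ext x
    obtain ⟨β, hβ⟩ := QuotientAddGroup.mk_surjective (q.1 ⟨x.1, trivial⟩)
    simp only [← hβ]
    exact congrArg QuotientAddGroup.mk ((congrArg β (map_zero (toRat F (genericPoint_mem x.2)))).trans (map_zero β))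
  map_add' := by
    intro f g
    refine Subtype.ext (funext fun x => ?_)
    have key : ∀ r : RatHom F E ⧸ homRegularAt F E x.1,
        evalStalk F E x.1 _ (toRat_mem_regularAt x.2 (f + g)) r =
          evalStalk F E x.1 _ (toRat_mem_regularAt x.2 f) r +
            evalStalk F E x.1 _ (toRat_mem_regularAt x.2 g) r := by
      intro r
      obtain ⟨β, rfl⟩ := QuotientAddGroup.mk_surjective r
      exact congrArg QuotientAddGroup.mk
        ((congrArg β (map_add (toRat F (genericPoint_mem x.2)) f g)).trans (map_add β _ _))
    exact key _

/-- The subsheaf `K ⊆ F` is the kernel of `q : F ⟶ Prin(E)`. -/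
def IsKer {F E : X.Modules} (q : PrinHom F E) (K : Subobject F) : Prop :=
  ∀ U : X.Opens, (K.arrow.app U).hom.range = (PrinHom.app q U).ker

end Rational

/-! ### `H¹(X, Hom(F, E))` -/

/-- A Čech `1`-cocycle with values in `Hom(F, E)`. We use open covers `(U x)` indexed by the points
of `X` with `x ∈ U x`; every open cover has a refinement of this kind. -/
structure HomCocycle (F E : X.Modules) where
  /-- the cover -/
  U : X → X.Opens
  mem_U : ∀ x, x ∈ U x
  /-- the cocycle -/
  c : ∀ x y, HomSections F E (U x ⊓ U y)
  cocycle : ∀ x y z,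
    HomSections.res (V := U x ⊓ U y ⊓ U z) inf_le_left (c x y) +
      HomSections.res (inf_le_inf_right _ inf_le_right) (c y z) =
    HomSections.res (inf_le_inf_right _ inf_le_left) (c x z)

/-- Two cocycles are cohomologous: on a common refinement of their covers they differ by a
coboundary. -/
def HomCocycle.Cohomologous {F E : X.Modules} (a b : HomCocycle F E) : Prop :=
  ∃ (V : X → X.Opens) (_ : ∀ x, x ∈ V x) (ha : ∀ x, V x ≤ a.U x) (hb : ∀ x, V x ≤ b.U x)
    (γ : ∀ x, HomSections F E (V x)), ∀ x y,
    HomSections.res (inf_le_inf (hb x) (hb y)) (b.c x y) -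
      HomSections.res (inf_le_inf (ha x) (ha y)) (a.c x y) =
    HomSections.res inf_le_right (γ y) - HomSections.res inf_le_left (γ x)

theorem HomSections.res_res {F E : X.Modules} {U V V' : X.Opens} (h : V ≤ U) (h' : V' ≤ V)
    (φ : HomSections F E U) : res h' (res h φ) = res (h'.trans h) φ := rfl

theorem HomCocycle.Cohomologous.refl {F E : X.Modules} (a : HomCocycle F E) :
    a.Cohomologous a := by
  refine ⟨a.U, a.mem_U, fun _ => le_rfl, fun _ => le_rfl, fun _ => 0, fun x y => ?_⟩
  rw [sub_self, map_zero, map_zero, sub_zero]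

theorem HomCocycle.Cohomologous.symm {F E : X.Modules} {a b : HomCocycle F E}
    (h : a.Cohomologous b) : b.Cohomologous a := by
  obtain ⟨V, hV, ha, hb, γ, h⟩ := h
  refine ⟨V, hV, hb, ha, fun x => -γ x, fun x y => ?_⟩
  rw [map_neg, map_neg, ← neg_sub, h x y]
  abel

theorem HomCocycle.Cohomologous.trans {F E : X.Modules} {a b c : HomCocycle F E}
    (h : a.Cohomologous b) (h' : b.Cohomologous c) : a.Cohomologous c := by
  obtain ⟨V, hV, ha, hb, γ, h⟩ := h
  obtain ⟨V', hV', hb', hc, γ', h'⟩ := h'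
  refine ⟨fun x => V x ⊓ V' x, fun x => ⟨hV x, hV' x⟩, fun x => inf_le_left.trans (ha x),
    fun x => inf_le_right.trans (hc x),
    fun x => HomSections.res inf_le_left (γ x) + HomSections.res inf_le_right (γ' x),
    fun x y => ?_⟩
  have e := congrArg (HomSections.res (V := (V x ⊓ V' x) ⊓ (V y ⊓ V' y))
    (inf_le_inf inf_le_left inf_le_left)) (h x y)
  have e' := congrArg (HomSections.res (V := (V x ⊓ V' x) ⊓ (V y ⊓ V' y))
    (inf_le_inf inf_le_right inf_le_right)) (h' x y)
  simp only [map_sub, map_add, HomSections.res_res] at e e' ⊢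
  rw [add_sub_add_comm, ← e, ← e']
  abel

/-- Being cohomologous is an equivalence relation. -/
instance HomCocycle.setoid (F E : X.Modules) : Setoid (HomCocycle F E) :=
  ⟨Cohomologous, Cohomologous.refl, Cohomologous.symm, Cohomologous.trans⟩

/-- The (Čech) cohomology `H¹(X, Hom(F, E))`. -/
def H1Hom (F E : X.Modules) : Type := _root_.Quotient (HomCocycle.setoid F E)

/-- `δ = δ(W) ∈ H¹(X, Hom(F, E))` is the class of the extension `0 ⟶ E ⟶ W ⟶ F ⟶ 0`: it is
represented by the cocycle `σ_y - σ_x`, where `σ_x` are splittings `F ⟶ W` over the members of an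
open cover. -/
def IsExtensionClass {E W F : X.Modules} (i : E ⟶ W) (π : W ⟶ F) (δ : H1Hom F E) : Prop :=
  ∃ c : HomCocycle F E, δ = _root_.Quotient.mk (HomCocycle.setoid F E) c ∧ ∃ σ : ∀ x, HomSections F W (c.U x),
    (∀ (x : X) (V : {V : X.Opens // V ≤ c.U x}) (f : Γ(F, V.1)), (π.app V.1).hom ((σ x).1 V f) = f) ∧
    ∀ (x y : X) (V : {V : X.Opens // V ≤ c.U x ⊓ c.U y}) (f : Γ(F, V.1)),
      (i.app V.1).hom ((c.c x y).1 V f) =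
        (σ y).1 ⟨V.1, V.2.trans inf_le_right⟩ f - (σ x).1 ⟨V.1, V.2.trans inf_le_left⟩ f

section Rational

variable [IsIntegral X]

/-- `δ = [q] ∈ H¹(X, Hom(F, E))` is the class of the principal part `q`, i.e. its image under the
connecting map of `0 ⟶ Hom(F, E) ⟶ Rat(Hom(F, E)) ⟶ Prin(Hom(F, E)) ⟶ 0`: it is represented by the
cocycle `b_y - b_x`, where `b_x` are rational sections whose principal parts are `q` over the
members of an open cover. -/
def IsPrincipalPartClass {F E : X.Modules} (q : PrinHom F E) (δ : H1Hom F E) : Prop :=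
  ∃ c : HomCocycle F E, δ = _root_.Quotient.mk (HomCocycle.setoid F E) c ∧ ∃ b : X → RatHom F E,
    (∀ x : X, ∀ y ∈ c.U x, q.1 ⟨y, trivial⟩ = QuotientAddGroup.mk (b x)) ∧
    ∀ x y : X, Induces (c.c x y) (b y - b x)

/-- The principal part `q` represents the class `δ(W)` of the extension `0 ⟶ E ⟶ W ⟶ F ⟶ 0`:
`[q] = δ(W)` in `H¹(X, Hom(F, E))`. -/
def RepresentsExtension {E W F : X.Modules} (i : E ⟶ W) (π : W ⟶ F) (q : PrinHom F E) : Prop :=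
  ∃ δ : H1Hom F E, IsExtensionClass i π δ ∧ IsPrincipalPartClass q δ

end Rational

/-! ### Elementary transformations that lift to subbundles -/

/-- An elementary transformation `K ⊆ F` of the bundle `F` of rank `n`, together with a lifting
of the inclusion `K ⟶ F` to `W` that embeds `K` as a vector subbundle of rank `n` of `W`. -/
structure LiftedElementaryTransformation {W F : X.Modules} (π : W ⟶ F) (n : ℕ) where
  /-- the elementary transformation -/
  K : Subobject F
  isElementaryTransformation : IsElementaryTransformation n K
  /-- the lifting -/
  lift : (K : X.Modules) ⟶ W
  lift_comp : lift ≫ π = K.arrow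
  isSubbundle : IsSubbundle lift n

/-- The lifting `K ⟶ W` is the one determined by `q`: it is the restriction to `K` of a rational
map `s : F ⇢ W` such that, at every point `x`, `s + i ∘ b` is regular for `b ∈ Rat(Hom(F, E))` with
principal part `q` at `x`. For `W = {(e, f) : f regular, p(f) = principal part of e}` this says that
`s(f) = (β(f), f)`, where `q = p - (principal part of β)`. -/
def IsLiftOf [IsIntegral X] {E W F : X.Modules} (i : E ⟶ W) {π : W ⟶ F} {n : ℕ} (q : PrinHom F E)
    (t : LiftedElementaryTransformation π n) : Prop :=
  ∃ s : RatHom F W,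
    (∀ (U : X.Opens) (h : genericPoint X ∈ U) (k : Γ((t.K : X.Modules), U)),
      toRat W h ((t.lift.app U).hom k) = s (toRat F h ((t.K.arrow.app U).hom k))) ∧
    ∀ (x : X) (b : RatHom F E), q.1 ⟨x, trivial⟩ = QuotientAddGroup.mk b →
      ∃ ρ ∈ homRegularAt F W x, ∀ f : RatSec F, ρ f = s f + ratMap i (b f)

end CurveExt

end

open CurveExt

/-! Both sides of the bijection are compared with a third set, the `K(X)`-linear splittings `s` of
`Rat(W) → Rat(F)`. This works because a section of a torsion-free sheaf over a nonempty open set is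
the same thing as a rational section that is regular at each point of that set.

From splittings to principal parts: locally `W → F` has regular splittings `σ_x`, and `σ_x - s = i ∘
β_x` for rational `β_x`. The differences `β_y - β_x` are regular, so the `β_x` form a principal part
`q`; since `i ∘ (β_y - β_x) = σ_y - σ_x`, the same cocycle represents `[q]` and `δ(W)`
(`exists_principalPart`). Conversely, if `[q] = δ(W)`, a coboundary `γ` makes the maps `σ_x + i ∘
γ_x - i ∘ b_x` independent of `x`, and their common value is a splitting `s` with `s + i ∘ b`
regular at `x` whenever `b` represents `q` there (`RepresentsExtension.exists_splitting`). Such an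
`s` determines `q`, and `q` determines `s` up to a global section of `Hom(F, E)`; this is where `h⁰
= 0` enters.

From splittings to subbundles: the sections of `W` lying in `s(Rat F)` form a saturated subsheaf.
The local rings are principal ideal domains, so a basis of `W_x` can be adapted to `s(Rat F)`, and
the subsheaf is a subbundle of rank `n`. Its image under `π` is the sheaf `K` of those `f` for which
`s f` is regular (`exists_liftedElementaryTransformation`). As `s f + i (b f)` is regular and `E_x =
Rat(E) ∩ W_x` (`ratLin_mem_regularAt_iff`), `s f` is regular exactly when `b f` is, so `K = Ker q`.
Conversely, `Rat(K) = Rat(F)` turns a lifting `j` into a splitting, and `(K, j)` is recovered from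
it because `W / K` is torsion-free (`LiftedElementaryTransformation.mem_range_iff`). -/

noncomputable section

namespace CurveExt

/-! ### Smooth algebras of relative dimension one over an algebraically closed field -/

section SmoothAlgebra

variable {k B : Type*} [Field k] [CommRing B] [Algebra k B]

/-- The derivation `b ↦ b - b(m)` with values in the cotangent space at a rational point `m`. -/
def cotangentDerivation {m : Ideal B} (ev : B →ₐ[k] k) (hev : ∀ b, ev b = 0 ↔ b ∈ m) :
    Derivation k B m.Cotangent :=
  have hmem : ∀ b, b - algebraMap k B (ev b) ∈ m := fun b => by
    rw [← hev, map_sub, AlgHom.commutes, Algebra.algebraMap_self, RingHom.id_apply, sub_self]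
  Derivation.mk'
    { toFun := fun b => m.toCotangent ⟨b - algebraMap k B (ev b), hmem b⟩
      map_add' := fun a b => by
        rw [← map_add]
        congr 1
        ext
        simp only [map_add, Submodule.coe_add]
        ring
      map_smul' := fun c b => by
        rw [RingHom.id_apply, ← algebraMap_smul B c (m.toCotangent _), ← map_smul]
        congr 1
        ext
        simp only [smul_eq_mul, map_mul, SetLike.val_smul, Algebra.smul_def, AlgHom.commutes,
          Algebra.algebraMap_self_apply]
        ring }
    (fun a b => by
      change m.toCotangent _ = a • m.toCotangent _ + b • m.toCotangent _
      rw [← map_smul, ← map_smul, ← map_add, m.toCotangent_eq]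
      have : (a * b - algebraMap k B (ev (a * b))) - (a * (b - algebraMap k B (ev b)) +
          b * (a - algebraMap k B (ev a))) =
          -((a - algebraMap k B (ev a)) * (b - algebraMap k B (ev b))) := by
        rw [map_mul, map_mul]; ring
      change (a * b - algebraMap k B (ev (a * b))) - (a * (b - algebraMap k B (ev b)) +
          b * (a - algebraMap k B (ev a))) ∈ m ^ 2
      rw [this, pow_two]
      exact neg_mem (Ideal.mul_mem_mul (hmem a) (hmem b)))

theorem cotangentDerivation_apply {m : Ideal B} (ev : B →ₐ[k] k) (hev : ∀ b, ev b = 0 ↔ b ∈ m)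
    {b : B} (hb : b ∈ m) : cotangentDerivation ev hev b = m.toCotangent ⟨b, hb⟩ := by
  change m.toCotangent _ = _
  congr 2
  rw [(hev b).2 hb, map_zero, sub_zero]

/-- The derivation `b ↦ b - b(m)` into `m / m²` factors through `Ω[B⁄k]`, which is free of rank one.
Hence `m / m²` is generated by the image `t` of a generator of `Ω[B⁄k]`. -/
theorem exists_le_span_sup_sq [IsAlgClosed k] [Algebra.IsStandardSmoothOfRelativeDimension 1 k B]
    (m : Ideal B) [hm : m.IsMaximal] : ∃ t ∈ m, m ≤ Ideal.span {t} ⊔ m ^ 2 := by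
  have : Nontrivial B := ⟨⟨0, 1, fun h => hm.ne_top ((Ideal.eq_top_iff_one _).2 (h ▸ m.zero_mem))⟩⟩
  have : Algebra.IsStandardSmooth k B :=
    Algebra.IsStandardSmoothOfRelativeDimension.isStandardSmooth 1
  have hrank : Module.finrank B Ω[B⁄k] = 1 := Module.finrank_eq_of_rank_eq (by
    rw [Algebra.IsStandardSmoothOfRelativeDimension.rank_kaehlerDifferential (n := 1)])
  let bas := Module.basisUnique Unit hrank
  let : Field (B ⧸ m) := Ideal.Quotient.field m
  -- By the Nullstellensatz the residue field is `k`, so `m` is the kernel of an evaluation `ev : B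
  -- → k`.
  have hfin : Module.Finite k (B ⧸ m) := finite_of_finite_type_of_isJacobsonRing k (B ⧸ m)
  have hbij := IsAlgClosed.algebraMap_bijective_of_isIntegral (k := k) (K := B ⧸ m)
  let e : k ≃ₐ[k] B ⧸ m := AlgEquiv.ofBijective (Algebra.ofId k (B ⧸ m)) hbij
  let ev : B →ₐ[k] k := (e.symm : (B ⧸ m) →ₐ[k] k).comp (Ideal.Quotient.mkₐ k m)
  have hev : ∀ b, ev b = 0 ↔ b ∈ m := fun b => by
    change e.symm (Ideal.Quotient.mk m b) = 0 ↔ _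
    rw [map_eq_zero_iff _ e.symm.injective, Ideal.Quotient.eq_zero_iff_mem]
  let L := (cotangentDerivation ev hev).liftKaehlerDifferential
  obtain ⟨t, ht⟩ := m.toCotangent_surjective (L (bas ()))
  refine ⟨t, t.2, fun x hx => ?_⟩
  have h1 : L (KaehlerDifferential.D k B x) = m.toCotangent ⟨x, hx⟩ := by
    rw [← cotangentDerivation_apply ev hev hx]
    exact Derivation.liftKaehlerDifferential_comp_D _ _
  have h2 : KaehlerDifferential.D k B x = bas.repr (KaehlerDifferential.D k B x) () • bas () := by
    conv_lhs => rw [← bas.sum_repr (KaehlerDifferential.D k B x)]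
    simp
  rw [h2, map_smul, ← ht, ← map_smul, m.toCotangent_eq] at h1
  set c := bas.repr (KaehlerDifferential.D k B x) ()
  have h3 : x = c * t - (c * t - x) := by ring
  rw [h3]
  exact sub_mem (Ideal.mem_sup_left (Ideal.mul_mem_left _ _ (Ideal.mem_span_singleton_self _)))
    (Ideal.mem_sup_right h1)

/-- A noetherian local domain is principal as soon as its maximal ideal is; here the parameter `t`
generates it by Nakayama's lemma. -/
theorem isPrincipalIdealRing_of_isMaximal [IsAlgClosed k] [IsDomain B]
    [Algebra.IsStandardSmoothOfRelativeDimension 1 k B] (m : Ideal B) [hm : m.IsMaximal]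
    (L : Type*) [CommRing L] [Algebra B L] [IsLocalization.AtPrime L m] :
    IsPrincipalIdealRing L := by
  have : Algebra.IsStandardSmooth k B :=
    Algebra.IsStandardSmoothOfRelativeDimension.isStandardSmooth 1
  have : IsNoetherianRing B := Algebra.FiniteType.isNoetherianRing k B
  have : IsNoetherianRing L := IsLocalization.isNoetherianRing m.primeCompl L inferInstance
  have : IsLocalRing L := IsLocalization.AtPrime.isLocalRing L m
  have : IsDomain L :=
    IsLocalization.isDomain_of_le_nonZeroDivisors L m.primeCompl_le_nonZeroDivisors
  refine ((tfae_of_isNoetherianRing_of_isLocalRing_of_isDomain L).out 0 4).2 ?_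
  obtain ⟨t, ht, hle⟩ := exists_le_span_sup_sq (k := k) m
  have hmap := IsLocalization.AtPrime.map_eq_maximalIdeal m L
  refine ⟨algebraMap B L t, le_antisymm ?_ ?_⟩
  · change _ ≤ Ideal.span _
    refine Submodule.le_of_le_smul_of_le_jacobson_bot (I := IsLocalRing.maximalIdeal L)
      (IsNoetherian.noetherian _) (IsLocalRing.jacobson_eq_maximalIdeal ⊥ bot_ne_top).ge ?_
    rw [smul_eq_mul, ← pow_two, ← hmap, ← Ideal.map_pow]
    refine (Ideal.map_mono hle).trans ?_
    rw [Ideal.map_sup, Ideal.map_span, Set.image_singleton]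
  · change Ideal.span _ ≤ _
    rw [Ideal.span_singleton_le_iff_mem, ← hmap]
    exact Ideal.mem_map_of_mem _ ht

/-- After localization at a maximal ideal above `p` the ring is principal, where nonzero primes are
maximal. -/
theorem isMaximal_of_isPrime [IsAlgClosed k] [IsDomain B]
    [Algebra.IsStandardSmoothOfRelativeDimension 1 k B] (p : Ideal B) [hp : p.IsPrime]
    (h0 : p ≠ ⊥) : p.IsMaximal := by
  obtain ⟨m, hm, hpm⟩ := p.exists_le_maximal hp.ne_top
  have hP := isPrincipalIdealRing_of_isMaximal (k := k) m (Localization.AtPrime m)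
  have hd : Disjoint (m.primeCompl : Set B) p := by
    rw [Set.disjoint_left]
    exact fun x hx hx' => hx (hpm hx')
  have hq := IsLocalization.isPrime_of_isPrime_disjoint m.primeCompl (Localization.AtPrime m) p hp hd
  have hc := IsLocalization.under_map_of_isPrime_disjoint m.primeCompl (Localization.AtPrime m) hp hd
  have hq0 : p.map (algebraMap B (Localization.AtPrime m)) ≠ ⊥ := by
    intro h
    rw [Ideal.map_eq_bot_iff_of_injective
      (IsLocalization.injective _ m.primeCompl_le_nonZeroDivisors)] at h
    exact h0 h
  have hmax := hq.isMaximal hq0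
  have := IsLocalRing.eq_maximalIdeal hmax
  rw [this] at hc
  have h2 := IsLocalization.AtPrime.under_maximalIdeal (Localization.AtPrime m) m
  rw [← hc, h2]
  exact hm

theorem isPrincipalIdealRing_of_isPrime [IsAlgClosed k] [IsDomain B]
    [Algebra.IsStandardSmoothOfRelativeDimension 1 k B] (p : Ideal B) [hp : p.IsPrime]
    (L : Type*) [CommRing L] [Algebra B L] [IsLocalization.AtPrime L p] :
    IsPrincipalIdealRing L := by
  by_cases h0 : p = ⊥
  · subst h0
    have : IsFractionRing B L := by
      have h : IsLocalization (⊥ : Ideal B).primeCompl L := inferInstance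
      rwa [show (⊥ : Ideal B).primeCompl = nonZeroDivisors B by
        ext; exact mem_nonZeroDivisors_iff_ne_zero.symm] at h
    let := IsFractionRing.toField B (K := L)
    exact inferInstance
  · have := isMaximal_of_isPrime (k := k) p h0
    exact isPrincipalIdealRing_of_isMaximal (k := k) p L

/-- All primes above `I ≠ 0` are maximal, hence minimal over `I`, and a noetherian ring has only
finitely many of these. -/
theorem finite_setOf_prime_ge [IsAlgClosed k] [IsDomain B]
    [Algebra.IsStandardSmoothOfRelativeDimension 1 k B] (I : Ideal B) (hI : I ≠ ⊥) :
    {p : PrimeSpectrum B | I ≤ p.asIdeal}.Finite := by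
  have : Algebra.IsStandardSmooth k B :=
    Algebra.IsStandardSmoothOfRelativeDimension.isStandardSmooth 1
  have : IsNoetherianRing B := Algebra.FiniteType.isNoetherianRing k B
  refine Set.Finite.of_finite_image
    ((Ideal.finite_minimalPrimes_of_isNoetherianRing B I).subset ?_)
    (f := PrimeSpectrum.asIdeal) (fun p _ q _ h => PrimeSpectrum.ext h)
  rintro _ ⟨p, hp, rfl⟩
  obtain ⟨q, hq, hqp⟩ := Ideal.exists_minimalPrimes_le (J := p.asIdeal) hp
  have : q.IsPrime := hq.1.1
  have hqm := isMaximal_of_isPrime (k := k) q (fun h => hI (le_bot_iff.1 (h ▸ hq.1.2)))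
  rwa [← hqm.eq_of_le p.2.ne_top hqp]

end SmoothAlgebra

/-! ### Smooth curves -/

section Curve

variable {X : Scheme.{0}}

theorem exists_isStandardSmooth_algebra (f : X ⟶ Spec (CommRingCat.of ℂ))
    [SmoothOfRelativeDimension 1 f] (x : X) :
    ∃ (V : X.Opens) (_ : IsAffineOpen V) (_ : x ∈ V) (_ : Algebra ℂ Γ(X, V)),
      Algebra.IsStandardSmoothOfRelativeDimension 1 ℂ Γ(X, V) := by
  obtain ⟨U, hU, V, hV, hx, e, h⟩ :=
    SmoothOfRelativeDimension.exists_isStandardSmoothOfRelativeDimension (n := 1) (f := f) x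
  -- `Spec ℂ` is a single point, so the affine open of the base is everything.
  have hUtop : U = ⊤ := by
    ext y
    simp only [SetLike.mem_coe, Opens.mem_top, iff_true]
    have : Subsingleton (PrimeSpectrum ℂ) := inferInstance
    have hy : y = f x := Subsingleton.elim (α := PrimeSpectrum ℂ) _ _
    rw [hy]
    exact e hx
  subst hUtop
  let eq : ℂ ≃+* Γ(Spec (CommRingCat.of ℂ), ⊤) :=
    (Scheme.ΓSpecIso (CommRingCat.of ℂ)).symm.commRingCatIsoToRingEquiv
  let g : ℂ →+* Γ(X, V) := (f.appLE ⊤ V e).hom.comp (eq : ℂ →+* _)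
  exact ⟨V, hV, hx, g.toAlgebra,
    h.comp (RingHom.IsStandardSmoothOfRelativeDimension.equiv eq)⟩

variable [IsIntegral X]

/-- The local rings of a smooth curve are principal ideal domains. -/
theorem isPrincipalIdealRing_stalk (f : X ⟶ Spec (CommRingCat.of ℂ))
    [SmoothOfRelativeDimension 1 f] (x : X) : IsPrincipalIdealRing (X.presheaf.stalk x) := by
  obtain ⟨V, hV, hx, _, _⟩ := exists_isStandardSmooth_algebra f x
  let := X.presheaf.algebra_section_stalk (U := V) ⟨x, hx⟩
  have := hV.isLocalization_stalk ⟨x, hx⟩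
  have : Nonempty V := ⟨⟨x, hx⟩⟩
  exact isPrincipalIdealRing_of_isPrime (k := ℂ) (hV.primeIdealOf ⟨x, hx⟩).asIdeal
    (X.presheaf.stalk x)

/-- Proper closed subsets of a quasi-compact smooth curve are finite. -/
theorem finite_compl (f : X ⟶ Spec (CommRingCat.of ℂ)) [IsProper f]
    [SmoothOfRelativeDimension 1 f] (U : X.Opens) (hU : genericPoint X ∈ U) :
    (U : Set X)ᶜ.Finite := by
  have : CompactSpace X := QuasiCompact.compactSpace_of_compactSpace f
  have key : ∀ x : X, ∃ V : X.Opens, x ∈ V ∧ ((U : Set X)ᶜ ∩ V).Finite := by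
    intro x
    obtain ⟨V, hV, hx, _, _⟩ := exists_isStandardSmooth_algebra f x
    have : Nonempty V := ⟨⟨x, hx⟩⟩
    refine ⟨V, hx, ?_⟩
    have hη : genericPoint X ∈ V := (genericPoint_specializes x).mem_open V.isOpen hx
    -- The complement of `U` in `V` lies in the zero locus of a nonzero function `g`.
    obtain ⟨g, hgU, hg⟩ := hV.exists_basicOpen_le (V := U) ⟨genericPoint X, hU⟩ hη
    have hg0 : Ideal.span {g} ≠ ⊥ := by
      rw [Ne, Ideal.span_singleton_eq_bot]
      rintro rfl
      rw [Scheme.basicOpen_zero] at hg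
      exact hg
    refine Set.Finite.subset (((finite_setOf_prime_ge (k := ℂ) _ hg0).image hV.fromSpec)) ?_
    rintro y ⟨hyU, hyV⟩
    refine ⟨hV.primeIdealOf ⟨y, hyV⟩, ?_, hV.fromSpec_primeIdealOf ⟨y, hyV⟩⟩
    change Ideal.span {g} ≤ _
    rw [Ideal.span_singleton_le_iff_mem]
    by_contra hgy
    apply hyU
    apply hgU
    have : hV.primeIdealOf ⟨y, hyV⟩ ∈ hV.fromSpec ⁻¹ᵁ (X.basicOpen g) := by
      rw [hV.fromSpec_preimage_basicOpen]
      exact hgy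
    have h2 : hV.fromSpec (hV.primeIdealOf ⟨y, hyV⟩) ∈ X.basicOpen g := this
    rwa [hV.fromSpec_primeIdealOf] at h2
  choose V hxV hfin using key
  obtain ⟨t, ht⟩ := isCompact_univ.elim_finite_subcover (fun x => (V x : Set X))
    (fun x => (V x).isOpen) (fun x _ => Set.mem_iUnion.2 ⟨x, hxV x⟩)
  refine (t.finite_toSet.biUnion (fun x _ => hfin x)).subset fun y hy => ?_
  obtain ⟨x, hxt, hyx⟩ := Set.mem_iUnion₂.1 (ht (Set.mem_univ y))
  exact Set.mem_biUnion hxt ⟨hy, hyx⟩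

end Curve

/-! ### Sections of sheaves of modules -/

section Sections

variable {X : Scheme.{0}} {M N : X.Modules} {U V V' : X.Opens}

theorem resSec_resSec (h : V ≤ U) (h' : V' ≤ V) (m : Γ(M, U)) :
    resSec M h' (resSec M h m) = resSec M (h'.trans h) m :=
  (ConcreteCategory.comp_apply (M.presheaf.map (homOfLE h).op) (M.presheaf.map (homOfLE h').op)
    m).symm.trans (by rw [← Functor.map_comp]; rfl)

theorem resSec_self (m : Γ(M, U)) : resSec M le_rfl m = m :=
  congrArg (fun φ : Γ(M, U) ⟶ Γ(M, U) => φ.hom m) (M.presheaf.map_id (Opposite.op U))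

theorem resSec_smul (h : V ≤ U) (r : Γ(X, U)) (m : Γ(M, U)) :
    resSec M h (r • m) = (X.presheaf.map (homOfLE h).op).hom r • resSec M h m :=
  Scheme.Modules.map_smul M (homOfLE h) r m

/-- The linear map on sections over `U` induced by a morphism of `𝒪_X`-modules. -/
def appLin (φ : M ⟶ N) (U : X.Opens) : Γ(M, U) →ₗ[Γ(X, U)] Γ(N, U) where
  toFun := (φ.app U).hom
  map_add' := map_add _
  map_smul' := Scheme.Modules.Hom.app_smul φ

theorem appLin_resSec (φ : M ⟶ N) (h : V ≤ U) (m : Γ(M, U)) :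
    appLin φ V (resSec M h m) = resSec N h (appLin φ U m) :=
  congrArg (fun ψ : Γ(M, U) ⟶ Γ(N, V) => ψ.hom m) (φ.mapPresheaf.naturality (homOfLE h).op)

theorem appLin_comp {L : X.Modules} (φ : M ⟶ N) (ψ : N ⟶ L) (m : Γ(M, U)) :
    appLin (φ ≫ ψ) U m = appLin ψ U (appLin φ U m) := rfl

theorem hom_eq_of_appLin_eq {φ ψ : M ⟶ N} (h : ∀ U m, appLin φ U m = appLin ψ U m) : φ = ψ := by
  ext U m
  exact h U m

theorem eq_of_locally_eq {m m' : Γ(M, U)}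
    (h : ∀ x ∈ U, ∃ (V : X.Opens) (hV : V ≤ U), x ∈ V ∧ resSec M hV m = resSec M hV m') :
    m = m' := by
  choose V hV hx hm using fun x : U => h x.1 x.2
  refine TopCat.Sheaf.eq_of_locally_eq' ⟨M.presheaf, M.isSheaf⟩ V U (fun x => homOfLE (hV x))
    (fun x hx' => Opens.mem_iSup.2 ⟨⟨x, hx'⟩, hx _⟩) m m' hm

theorem exists_glue {ι : Type} (V : ι → X.Opens) (hV : ∀ j, V j ≤ U) (hcov : ∀ x ∈ U, ∃ j, x ∈ V j)
    (s : ∀ j, Γ(M, V j))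
    (hs : ∀ j j', resSec M (inf_le_left : V j ⊓ V j' ≤ V j) (s j) =
      resSec M (inf_le_right : V j ⊓ V j' ≤ V j') (s j')) :
    ∃ m : Γ(M, U), ∀ j, resSec M (hV j) m = s j := by
  obtain ⟨m, hm, -⟩ := TopCat.Sheaf.existsUnique_gluing' ⟨M.presheaf, M.isSheaf⟩ V U
    (fun x => homOfLE (hV x)) (fun x hx' => Opens.mem_iSup.2 (hcov x hx')) s hs
  exact ⟨m, hm⟩

/-! ### Subsheaves -/

/-- A family of submodules of the modules of sections of `M` that is stable under restriction and
of local nature. -/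
structure SubsheafData (M : X.Modules) where
  /-- the sections over an open set -/
  obj : ∀ U : X.Opens, Submodule Γ(X, U) Γ(M, U)
  res : ∀ (U V : X.Opens) (h : V ≤ U) (m : Γ(M, U)), m ∈ obj U → resSec M h m ∈ obj V
  loc : ∀ (U : X.Opens) (m : Γ(M, U)),
    (∀ x ∈ U, ∃ (V : X.Opens) (h : V ≤ U), x ∈ V ∧ resSec M h m ∈ obj V) → m ∈ obj U

namespace SubsheafData

variable (S : SubsheafData M)

/-- The family of submodules, as a subobject of the presheaf of modules. -/
def submodule : PresheafOfModules.Submodule (R := X.ringCatSheaf.obj) M.val where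
  obj U := S.obj U.unop
  map {U V} f m hm := S.res U.unop V.unop f.unop.le m hm

theorem isSheaf : TopCat.Presheaf.IsSheaf (C := Ab) (X := X.carrier)
    (PresheafOfModules.presheaf S.submodule.toPresheafOfModules) := by
  refine (TopCat.Presheaf.isSheaf_iff_isSheafUniqueGluing (C := Ab) _).2 ?_
  intro ι U sf hsf
  have hcov : ∀ x ∈ iSup U, ∃ j, x ∈ U j := fun x hx => Opens.mem_iSup.1 hx
  obtain ⟨m, hm⟩ := exists_glue (M := M) U (le_iSup U) hcov (fun j => (sf j).1)
    (fun j j' => congrArg Subtype.val (hsf j j'))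
  have hmS : m ∈ S.obj (iSup U) := S.loc _ _ fun x hx => by
    obtain ⟨j, hj⟩ := hcov x hx
    refine ⟨U j, le_iSup U j, hj, ?_⟩
    rw [hm j]
    exact (sf j).2
  refine ⟨⟨m, hmS⟩, fun j => Subtype.ext (hm j), fun m' hm' => Subtype.ext ?_⟩
  refine eq_of_locally_eq (M := M) fun x hx => ?_
  obtain ⟨j, hj⟩ := hcov x hx
  exact ⟨U j, le_iSup U j, hj, (congrArg Subtype.val (hm' j)).trans (hm j).symm⟩

/-- The subsheaf of `M` defined by the family of submodules. -/
def toModules : X.Modules where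
  val := S.submodule.toPresheafOfModules
  isSheaf := S.isSheaf

/-- The inclusion of a subsheaf. -/
def ι : S.toModules ⟶ M := ⟨S.submodule.ι⟩

theorem appLin_ι_injective (U : X.Opens) : Function.Injective (appLin S.ι U) :=
  fun _ _ h => Subtype.ext h

theorem mem_range_appLin_ι (U : X.Opens) (m : Γ(M, U)) :
    m ∈ LinearMap.range (appLin S.ι U) ↔ m ∈ S.obj U :=
  ⟨by rintro ⟨y, rfl⟩; exact y.2, fun h => ⟨⟨m, h⟩, rfl⟩⟩

end SubsheafData

theorem mono_of_appLin_injective (φ : M ⟶ N) (h : ∀ U, Function.Injective (appLin φ U)) :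
    Mono φ where
  right_cancellation g g' hg := hom_eq_of_appLin_eq fun U m => h U (by
    rw [← appLin_comp, ← appLin_comp, hg])

instance SubsheafData.mono_ι (S : SubsheafData M) : Mono S.ι :=
  mono_of_appLin_injective _ S.appLin_ι_injective

/-- The subsheaf of sections that are killed by a morphism. -/
def kerData (φ : M ⟶ N) : SubsheafData M where
  obj U := LinearMap.ker (appLin φ U)
  res U V h m hm := by
    rw [LinearMap.mem_ker] at hm ⊢
    rw [appLin_resSec, hm, map_zero]
  loc U m hm := by
    rw [LinearMap.mem_ker]
    refine eq_of_locally_eq fun x hx => ?_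
    obtain ⟨V, hV, hxV, h⟩ := hm x hx
    exact ⟨V, hV, hxV, by rw [← appLin_resSec, LinearMap.mem_ker.1 h, map_zero]⟩

/-- The subsheaf of sections that are locally in the image of a morphism. -/
def imageData (φ : M ⟶ N) : SubsheafData N where
  obj U :=
    { carrier := {n | ∀ x ∈ U, ∃ (V : X.Opens) (h : V ≤ U), x ∈ V ∧
        resSec N h n ∈ LinearMap.range (appLin φ V)}
      add_mem' := by
        rintro a b ha hb x hx
        obtain ⟨V, hV, hxV, m, hm⟩ := ha x hx
        obtain ⟨V', hV', hxV', m', hm'⟩ := hb x hx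
        refine ⟨V ⊓ V', inf_le_left.trans hV, ⟨hxV, hxV'⟩,
          resSec M inf_le_left m + resSec M inf_le_right m', ?_⟩
        rw [map_add, map_add, appLin_resSec, appLin_resSec, hm, hm', resSec_resSec, resSec_resSec]
      zero_mem' := fun x hx => ⟨U, le_rfl, hx, 0, by rw [map_zero, map_zero]⟩
      smul_mem' := by
        rintro r a ha x hx
        obtain ⟨V, hV, hxV, m, hm⟩ := ha x hx
        exact ⟨V, hV, hxV, _ • m, by rw [map_smul, hm, resSec_smul]⟩ }
  res U V h n hn x hx := by
    obtain ⟨V', hV', hxV', m, hm⟩ := hn x (h hx)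
    refine ⟨V' ⊓ V, inf_le_right, ⟨hxV', hx⟩, resSec M inf_le_left m, ?_⟩
    rw [appLin_resSec, hm, resSec_resSec, resSec_resSec]
  loc U n hn x hx := by
    obtain ⟨V, hV, hxV, h⟩ := hn x hx
    obtain ⟨V', hV', hxV', m, hm⟩ := h x hxV
    exact ⟨V', hV'.trans hV, hxV', m, by rw [hm, resSec_resSec]⟩

/-- The inclusion of the kernel subsheaf is killed by the monomorphism `φ`, hence is zero. -/
theorem appLin_injective (φ : M ⟶ N) [Mono φ] (U : X.Opens) : Function.Injective (appLin φ U) := by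
  rw [← LinearMap.ker_eq_bot, eq_bot_iff]
  intro m hm
  have h0 : (kerData φ).ι = 0 := by
    rw [← cancel_mono φ, zero_comp]
    refine hom_eq_of_appLin_eq fun V y => ?_
    exact LinearMap.mem_ker.1 y.2
  obtain ⟨y, rfl⟩ := ((kerData φ).mem_range_appLin_ι U m).2 hm
  rw [h0]
  exact zero_mem _

theorem appLin_bijective (φ : M ⟶ N) [IsIso φ] (U : X.Opens) : Function.Bijective (appLin φ U) :=
  (ConcreteCategory.isIso_iff_bijective (φ.app U)).1 inferInstance

/-- A morphism that takes values in a subsheaf factors through it. -/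
theorem exists_fac (S : SubsheafData N) (φ : M ⟶ N) (h : ∀ U m, appLin φ U m ∈ S.obj U) :
    ∃ ψ : M ⟶ S.toModules, ψ ≫ S.ι = φ := by
  refine ⟨⟨PresheafOfModules.homMk (M₁ := M.val) (M₂ := S.submodule.toPresheafOfModules)
    { app := fun U => AddCommGrpCat.ofHom
        ((appLin φ U.unop).codRestrict (S.obj U.unop) (h U.unop)).toAddMonoidHom
      naturality := ?_ } ?_⟩, ?_⟩
  · intro U V f
    ext m
    exact Subtype.ext (appLin_resSec φ f.unop.le m)
  · intro U r m
    exact Subtype.ext (Scheme.Modules.Hom.app_smul φ (U := U.unop) r m)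
  · rfl

/-- `φ` factors through the subsheaf of sections that are locally in its image. The inclusion of
that subsheaf is both mono and epi, hence an isomorphism. -/
theorem exists_appLin_eq_of_epi (φ : M ⟶ N) [Epi φ] {x : X} (hx : x ∈ U) (n : Γ(N, U)) :
    ∃ (V : X.Opens) (h : V ≤ U), x ∈ V ∧ ∃ m, appLin φ V m = resSec N h n := by
  obtain ⟨ψ, hψ⟩ := exists_fac (imageData φ) φ (fun U m y hy =>
    ⟨U, le_rfl, hy, m, (resSec_self _).symm⟩)
  have : Epi (imageData φ).ι := epi_of_epi_fac hψ
  have : IsIso (imageData φ).ι := isIso_of_mono_of_epi _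
  obtain ⟨y, hy⟩ := (appLin_bijective (imageData φ).ι U).2 n
  obtain ⟨V, hV, hxV, m, hm⟩ := y.2 x hx
  exact ⟨V, hV, hxV, m, by rw [hm, ← hy]; rfl⟩

/-- Left exactness of the functor of sections. -/
theorem exists_appLin_eq_of_exact {L : X.Modules} {φ : L ⟶ M} {ψ : M ⟶ N} {w : φ ≫ ψ = 0} [Mono φ]
    (h : (ShortComplex.mk φ ψ w).Exact) (m : Γ(M, U)) (hm : appLin ψ U m = 0) :
    ∃ l, appLin φ U l = m := by
  have hk : (kerData ψ).ι ≫ ψ = 0 := hom_eq_of_appLin_eq fun V y => LinearMap.mem_ker.1 y.2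
  have : Mono (ShortComplex.mk φ ψ w).f := ‹_›
  have hl : h.lift (kerData ψ).ι hk ≫ φ = (kerData ψ).ι := h.lift_f _ _
  obtain ⟨y, rfl⟩ := ((kerData ψ).mem_range_appLin_ι U m).2 hm
  exact ⟨appLin (h.lift (kerData ψ).ι hk) U y, by rw [← appLin_comp, hl]⟩

/-- A monomorphism factors through another one if it does so on sections. -/
theorem exists_fac_of_range_le {K K' : X.Modules} (k : K ⟶ M) (k' : K' ⟶ M) [Mono k']
    (h : ∀ U, LinearMap.range (appLin k U) ≤ LinearMap.range (appLin k' U)) :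
    ∃ l : K ⟶ K', l ≫ k' = k := by
  have h0 : k ≫ cokernel.π k' = 0 := hom_eq_of_appLin_eq fun U m => by
    obtain ⟨y, hy⟩ := h U ⟨m, rfl⟩
    rw [appLin_comp, ← hy, ← appLin_comp, cokernel.condition]
    rfl
  exact ⟨Abelian.monoLift k' k h0, Abelian.monoLift_comp k' k h0⟩

end Sections

/-! ### Rational sections -/

section RationalSections

variable {X : Scheme.{0}} [IsIntegral X] {M N : X.Modules} {U V : X.Opens}

theorem toRat_resSec (h : V ≤ U) (hV : genericPoint X ∈ V) (m : Γ(M, U)) :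
    toRat M hV (resSec M h m) = toRat M (h hV) m :=
  TopCat.Presheaf.germ_res_apply' _ _ _ _ _

theorem toRat_smul (hU : genericPoint X ∈ U) (r : Γ(X, U)) (m : Γ(M, U)) :
    toRat M hU (r • m) =
      (X.presheaf.germ U (genericPoint X) hU r : X.functionField) • toRat M hU m :=
  toRat_germ_smul M U hU r m

theorem exists_toRat_eq (hU : genericPoint X ∈ U) (r : RatSec M) :
    ∃ (V : X.Opens) (_ : V ≤ U) (hV : genericPoint X ∈ V) (m : Γ(M, V)), toRat M hV m = r := by
  obtain ⟨V, hV, m, rfl⟩ := M.presheaf.exists_germ_eq r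
  exact ⟨V ⊓ U, inf_le_right, ⟨hV, hU⟩, resSec M inf_le_left m, toRat_resSec _ _ _⟩

theorem exists_resSec_eq (hU : genericPoint X ∈ U) {m m' : Γ(M, U)}
    (h : toRat M hU m = toRat M hU m') :
    ∃ (V : X.Opens) (hV : V ≤ U), genericPoint X ∈ V ∧ resSec M hV m = resSec M hV m' := by
  obtain ⟨V, hV, i, j, e⟩ := M.presheaf.germ_eq (genericPoint X) hU hU m m' h
  exact ⟨V, i.le, hV, e⟩

theorem ratMap_toRat (φ : M ⟶ N) (hU : genericPoint X ∈ U) (m : Γ(M, U)) :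
    ratMap φ (toRat M hU m) = toRat N hU (appLin φ U m) :=
  TopCat.Presheaf.stalkFunctor_map_germ_apply U (genericPoint X) hU φ.mapPresheaf m

theorem exists_germ_eq_le (hU : genericPoint X ∈ U) (c : X.functionField) :
    ∃ (V : X.Opens) (_ : V ≤ U) (hV : genericPoint X ∈ V) (g : Γ(X, V)),
      X.presheaf.germ V (genericPoint X) hV g = c := by
  obtain ⟨V, hV, m, rfl⟩ := X.presheaf.exists_germ_eq c
  exact ⟨V ⊓ U, inf_le_right, ⟨hV, hU⟩, X.presheaf.map (homOfLE inf_le_left).op m,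
    TopCat.Presheaf.germ_res_apply' _ _ _ _ _⟩

theorem ratMap_smul (φ : M ⟶ N) (c : X.functionField) (r : RatSec M) :
    ratMap φ (c • r) = c • ratMap φ r := by
  obtain ⟨U, -, hU, g, rfl⟩ := exists_germ_eq_le (U := ⊤) trivial c
  obtain ⟨V, hVU, hV, m, rfl⟩ := exists_toRat_eq hU r
  have : (X.presheaf.germ U (genericPoint X) hU g : X.functionField) =
      X.presheaf.germ V (genericPoint X) hV (X.presheaf.map (homOfLE hVU).op g) :=
    (TopCat.Presheaf.germ_res_apply' _ _ _ _ _).symm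
  rw [this, ← toRat_smul, ratMap_toRat, ratMap_toRat, map_smul, toRat_smul]

/-- The map `Rat(M) → Rat(N)` induced by a morphism, as a linear map. -/
def ratLin (φ : M ⟶ N) : RatHom M N where
  toFun := ratMap φ
  map_add' := map_add _
  map_smul' := ratMap_smul φ

theorem ratLin_toRat (φ : M ⟶ N) (hU : genericPoint X ∈ U) (m : Γ(M, U)) :
    ratLin φ (toRat M hU m) = toRat N hU (appLin φ U m) :=
  ratMap_toRat φ hU m

theorem ratLin_comp {L : X.Modules} (φ : M ⟶ N) (ψ : N ⟶ L) :
    ratLin (φ ≫ ψ) = ratLin ψ ∘ₗ ratLin φ := by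
  ext r
  obtain ⟨U, -, hU, m, rfl⟩ := exists_toRat_eq (U := ⊤) trivial r
  rw [LinearMap.comp_apply, ratLin_toRat, ratLin_toRat, ratLin_toRat, appLin_comp]

theorem ratLin_mem_regularAt (φ : M ⟶ N) {x : X} {r : RatSec M} (hr : r ∈ regularAt M x) :
    ratLin φ r ∈ regularAt N x := by
  obtain ⟨U, hx, m, rfl⟩ := hr
  exact ⟨U, hx, appLin φ U m, (ratLin_toRat φ _ m).symm⟩

theorem ratLin_injective (φ : M ⟶ N) [Mono φ] : Function.Injective (ratLin φ) := by
  rw [← LinearMap.ker_eq_bot, eq_bot_iff]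
  intro r hr
  obtain ⟨U, -, hU, m, rfl⟩ := exists_toRat_eq (U := ⊤) trivial r
  rw [LinearMap.mem_ker, ratLin_toRat, ← map_zero (toRat N hU)] at hr
  obtain ⟨V, hVU, hV, h⟩ := exists_resSec_eq hU hr
  rw [map_zero, ← appLin_resSec, ← map_zero (appLin φ V)] at h
  rw [Submodule.mem_bot, ← toRat_resSec hVU hV, appLin_injective φ V h, map_zero]

theorem exists_ratLin_eq_of_exact {L : X.Modules} {φ : L ⟶ M} {ψ : M ⟶ N} {w : φ ≫ ψ = 0} [Mono φ]
    (h : (ShortComplex.mk φ ψ w).Exact) (r : RatSec M) (hr : ratLin ψ r = 0) :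
    ∃ l, ratLin φ l = r := by
  obtain ⟨U, -, hU, m, rfl⟩ := exists_toRat_eq (U := ⊤) trivial r
  rw [ratLin_toRat, ← map_zero (toRat N hU)] at hr
  obtain ⟨V, hVU, hV, e⟩ := exists_resSec_eq hU hr
  rw [map_zero, ← appLin_resSec] at e
  obtain ⟨l, hl⟩ := exists_appLin_eq_of_exact h _ e
  exact ⟨toRat L hV l, by rw [ratLin_toRat, hl, toRat_resSec]⟩

theorem ratLin_comp_eq_zero {L : X.Modules} {φ : L ⟶ M} {ψ : M ⟶ N} (w : φ ≫ ψ = 0)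
    (r : RatSec L) : ratLin ψ (ratLin φ r) = 0 := by
  obtain ⟨U, -, hU, m, rfl⟩ := exists_toRat_eq (U := ⊤) trivial r
  rw [ratLin_toRat, ratLin_toRat, ← appLin_comp, w]
  exact map_zero _

theorem exists_ratLin_eq_of_epi (φ : M ⟶ N) [Epi φ] {x : X} {r : RatSec N}
    (hr : r ∈ regularAt N x) : ∃ l ∈ regularAt M x, ratLin φ l = r := by
  obtain ⟨U, hx, m, rfl⟩ := hr
  obtain ⟨V, hVU, hV, l, hl⟩ := exists_appLin_eq_of_epi φ hx m
  exact ⟨_, toRat_mem_regularAt hV l, by rw [ratLin_toRat, hl, toRat_resSec]⟩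

theorem mem_regularAt_genericPoint (r : RatSec M) : r ∈ regularAt M (genericPoint X) := by
  obtain ⟨U, -, hU, m, rfl⟩ := exists_toRat_eq (U := ⊤) trivial r
  exact ⟨U, hU, m, rfl⟩

theorem regularAt_open {x : X} {r : RatSec M} (hr : r ∈ regularAt M x) :
    ∃ U : X.Opens, x ∈ U ∧ ∀ y ∈ U, r ∈ regularAt M y := by
  obtain ⟨U, hx, m, rfl⟩ := hr
  exact ⟨U, hx, fun y hy => ⟨U, hy, m, rfl⟩⟩

theorem subsingleton_sections (hU : genericPoint X ∉ U) : Subsingleton Γ(M, U) :=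
  ⟨fun _ _ => eq_of_locally_eq fun _ hx => (hU (genericPoint_mem hx)).elim⟩

/-! ### Regular functions -/

/-- The rational functions that are regular at `x`. -/
def regularFun (x : X) : Subring X.functionField :=
  (algebraMap (X.presheaf.stalk x) X.functionField).range

theorem algebraMap_germ {x : X} (hx : x ∈ U) (g : Γ(X, U)) :
    algebraMap (X.presheaf.stalk x) X.functionField (X.presheaf.germ U x hx g) =
      X.presheaf.germ U (genericPoint X) (genericPoint_mem hx) g := by
  have : Nonempty U := ⟨⟨x, hx⟩⟩
  exact Scheme.algebraMap_germ_eq_germToFunctionField X hx g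

theorem mem_regularFun_iff {x : X} {c : X.functionField} :
    c ∈ regularFun x ↔ ∃ (U : X.Opens) (hx : x ∈ U) (g : Γ(X, U)),
      X.presheaf.germ U (genericPoint X) (genericPoint_mem hx) g = c := by
  constructor
  · rintro ⟨d, rfl⟩
    obtain ⟨U, hx, g, rfl⟩ := X.presheaf.exists_germ_eq d
    exact ⟨U, hx, g, (algebraMap_germ hx g).symm⟩
  · rintro ⟨U, hx, g, rfl⟩
    exact ⟨_, algebraMap_germ hx g⟩

theorem regularFun_open {x : X} {c : X.functionField} (hc : c ∈ regularFun x) :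
    ∃ U : X.Opens, x ∈ U ∧ ∀ y ∈ U, c ∈ regularFun y := by
  obtain ⟨U, hx, g, rfl⟩ := mem_regularFun_iff.1 hc
  exact ⟨U, hx, fun y hy => mem_regularFun_iff.2 ⟨U, hy, g, rfl⟩⟩

theorem germ_mem_regularFun {x : X} (hx : x ∈ U) (hU : genericPoint X ∈ U) (g : Γ(X, U)) :
    (X.presheaf.germ U (genericPoint X) hU g : X.functionField) ∈ regularFun x :=
  mem_regularFun_iff.2 ⟨U, hx, g, rfl⟩

theorem smul_mem_regularAt {x : X} {c : X.functionField} {r : RatSec M} (hc : c ∈ regularFun x)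
    (hr : r ∈ regularAt M x) : c • r ∈ regularAt M x := by
  obtain ⟨U, hx, g, rfl⟩ := mem_regularFun_iff.1 hc
  obtain ⟨V, hx', m, rfl⟩ := hr
  refine ⟨U ⊓ V, ⟨hx, hx'⟩, X.presheaf.map (homOfLE (inf_le_left : U ⊓ V ≤ U)).op g •
    resSec M (inf_le_right : U ⊓ V ≤ V) m, ?_⟩
  rw [toRat_smul, toRat_resSec]
  congr 1
  exact TopCat.Presheaf.germ_res_apply' _ _ _ _ _

theorem germ_genericPoint_injective (hU : genericPoint X ∈ U) :
    Function.Injective (X.presheaf.germ U (genericPoint X) hU) :=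
  germ_injective_of_isIntegral X (genericPoint X) hU

/-- A rational function that is regular on `U` is a section of the structure sheaf over `U`. -/
theorem exists_germ_eq_of_regular (hU : genericPoint X ∈ U) (c : X.functionField)
    (hc : ∀ x ∈ U, c ∈ regularFun x) :
    ∃ g : Γ(X, U), (X.presheaf.germ U (genericPoint X) hU g : X.functionField) = c := by
  have key : ∀ x : U, ∃ (V : X.Opens) (_ : V ≤ U) (hx : x.1 ∈ V) (g : Γ(X, V)),
      (X.presheaf.germ V (genericPoint X) (genericPoint_mem hx) g : X.functionField) = c := by
    intro x
    obtain ⟨V, hx, g, rfl⟩ := mem_regularFun_iff.1 (hc x.1 x.2)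
    exact ⟨V ⊓ U, inf_le_right, ⟨hx, x.2⟩, X.presheaf.map (homOfLE inf_le_left).op g,
      TopCat.Presheaf.germ_res_apply' _ _ _ _ _⟩
  choose V hVU hx g hg using key
  obtain ⟨s, hs, -⟩ := TopCat.Sheaf.existsUnique_gluing' X.sheaf V U (fun x => homOfLE (hVU x))
    (fun x hx' => Opens.mem_iSup.2 ⟨⟨x, hx'⟩, hx _⟩) g (fun x y => by
      refine germ_genericPoint_injective (U := V x ⊓ V y)
        ⟨genericPoint_mem (hx x), genericPoint_mem (hx y)⟩ ?_
      refine (TopCat.Presheaf.germ_res_apply' X.presheaf _ _ _ _).trans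
        (Eq.trans ?_ (TopCat.Presheaf.germ_res_apply' X.presheaf _ _ _ _).symm)
      exact (hg x).trans (hg y).symm)
  refine ⟨s, ?_⟩
  rw [← hg ⟨_, hU⟩, ← hs ⟨_, hU⟩]
  exact (TopCat.Presheaf.germ_res_apply' X.presheaf _ _ _ _).symm

end RationalSections

/-! ### Torsion-free and locally free sheaves -/

section LocallyFree

variable {X : Scheme.{0}}

theorem exists_open_forall {ι : Type*} [Finite ι] {x : X} {P : ι → X → Prop}
    (h : ∀ k, ∃ U : X.Opens, x ∈ U ∧ ∀ y ∈ U, P k y) :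
    ∃ U : X.Opens, x ∈ U ∧ ∀ y ∈ U, ∀ k, P k y := by
  have : ∀ᶠ y in nhds x, ∀ k, P k y := Filter.eventually_all.2 fun k => by
    obtain ⟨U, hx, hU⟩ := h k
    exact Filter.eventually_of_mem (U.isOpen.mem_nhds hx) hU
  obtain ⟨t, ht, hto, hx⟩ := eventually_nhds_iff.1 this
  exact ⟨⟨t, hto⟩, hx, ht⟩

variable [IsIntegral X] {M N : X.Modules} {U V : X.Opens}

/-- Sections are determined by the rational sections that they define. -/
def IsTorsionFree (M : X.Modules) : Prop :=
  ∀ (U : X.Opens) (h : genericPoint X ∈ U), Function.Injective (toRat M h)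

/-- A rational section that is regular on `U` is a section over `U`. -/
theorem IsTorsionFree.exists_toRat_eq (hM : IsTorsionFree M) (hU : genericPoint X ∈ U)
    (r : RatSec M) (hr : ∀ x ∈ U, r ∈ regularAt M x) : ∃ m : Γ(M, U), toRat M hU m = r := by
  have key : ∀ x : U, ∃ (V : X.Opens) (_ : V ≤ U) (hx : x.1 ∈ V) (m : Γ(M, V)),
      toRat M (genericPoint_mem hx) m = r := by
    intro x
    obtain ⟨V, hx, m, rfl⟩ := hr x.1 x.2
    exact ⟨V ⊓ U, inf_le_right, ⟨hx, x.2⟩, resSec M inf_le_left m, toRat_resSec _ _ _⟩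
  choose V hVU hx m hm using key
  obtain ⟨s, hs⟩ := exists_glue V hVU (fun x hx' => ⟨⟨x, hx'⟩, hx _⟩) m (fun x y => by
    have hη : genericPoint X ∈ V x ⊓ V y := ⟨genericPoint_mem (hx x), genericPoint_mem (hx y)⟩
    refine hM (V x ⊓ V y) hη ?_
    rw [toRat_resSec, toRat_resSec, hm, hm])
  refine ⟨s, ?_⟩
  rw [← hm ⟨_, hU⟩, ← hs ⟨_, hU⟩, toRat_resSec]

/-- The basis `b` of `Rat(M)` is a basis of the stalk `M_x`. -/
def IsLocalBasis {ι : Type*} (b : Module.Basis ι X.functionField (RatSec M)) (x : X) : Prop :=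
  ∀ r, r ∈ regularAt M x ↔ ∀ k, b.repr r k ∈ regularFun x

theorem IsLocalBasis.mem {ι : Type*} {b : Module.Basis ι X.functionField (RatSec M)} {x : X}
    (hb : IsLocalBasis b x) (k : ι) : b k ∈ regularAt M x := by
  classical
  refine (hb _).2 fun l => ?_
  rw [b.repr_self, Finsupp.single_apply]
  split_ifs
  · exact one_mem _
  · exact zero_mem _

theorem IsLocalBasis.reindex {ι κ : Type*} {b : Module.Basis ι X.functionField (RatSec M)} {x : X}
    (hb : IsLocalBasis b x) (e : ι ≃ κ) : IsLocalBasis (b.reindex e) x := by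
  intro r
  rw [hb r]
  refine ⟨fun h k => ?_, fun h k => ?_⟩
  · rw [b.repr_reindex_apply]
    exact h _
  · have := h (e k)
    rwa [b.repr_reindex_apply, e.symm_apply_apply] at this

/-- Two bases of the stalk at `x` are bases of the same stalks near `x`. -/
theorem IsLocalBasis.spread {ι κ : Type*} [Finite ι] [Finite κ]
    {b : Module.Basis ι X.functionField (RatSec M)}
    {b' : Module.Basis κ X.functionField (RatSec M)} {x : X} {U : X.Opens} (hx : x ∈ U)
    (hb : ∀ y ∈ U, IsLocalBasis b y) (hb' : IsLocalBasis b' x) :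
    ∃ V : X.Opens, x ∈ V ∧ V ≤ U ∧ ∀ y ∈ V, IsLocalBasis b' y := by
  cases nonempty_fintype ι
  cases nonempty_fintype κ
  -- The entries of both change-of-basis matrices are regular at `x`, hence near `x`.
  obtain ⟨V₁, hx₁, h₁⟩ := exists_open_forall (x := x)
    (P := fun (p : ι × κ) y => b.repr (b' p.2) p.1 ∈ regularFun y)
    (fun p => regularFun_open ((hb x hx _).1 (hb'.mem p.2) p.1))
  obtain ⟨V₂, hx₂, h₂⟩ := exists_open_forall (x := x)
    (P := fun (p : ι × κ) y => b'.repr (b p.1) p.2 ∈ regularFun y)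
    (fun p => regularFun_open ((hb' _).1 ((hb x hx).mem p.1) p.2))
  refine ⟨U ⊓ (V₁ ⊓ V₂), ⟨hx, hx₁, hx₂⟩, inf_le_left, fun y hy r => ?_⟩
  rw [hb y hy.1]
  constructor
  · intro h k
    rw [← b.sum_repr r, map_sum, Finsupp.finsetSum_apply]
    refine sum_mem fun l _ => ?_
    rw [map_smul, Finsupp.smul_apply, smul_eq_mul]
    exact mul_mem (h l) (h₂ y hy.2.2 (l, k))
  · intro h k
    rw [← b'.sum_repr r, map_sum, Finsupp.finsetSum_apply]
    refine sum_mem fun l _ => ?_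
    rw [map_smul, Finsupp.smul_apply, smul_eq_mul]
    exact mul_mem (h l) (h₁ y hy.2.1 (k, l))

theorem mem_regularFun_genericPoint (c : X.functionField) : c ∈ regularFun (genericPoint X) := by
  obtain ⟨U, -, hU, g, rfl⟩ := exists_germ_eq_le (U := ⊤) trivial c
  exact germ_mem_regularFun hU hU g

/-! ### Local frames and bases of the generic stalk -/

section Frame

variable {n : ℕ} {e : Fin n → Γ(M, U)}
  (he : ∀ (V : X.Opens) (h : V ≤ U), LinearIndependent Γ(X, V) (fun k => resSec M h (e k)) ∧
    Submodule.span Γ(X, V) (Set.range fun k => resSec M h (e k)) = ⊤)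

include he

theorem linearIndependent_toRat_of_frame (hU : genericPoint X ∈ U) :
    LinearIndependent X.functionField (fun k => toRat M hU (e k)) := by
  rw [Fintype.linearIndependent_iff]
  intro c hc
  -- The coefficients of a relation over `K(X)` are functions near the generic point, and the
  -- relation holds between sections over a smaller open set, where the frame is independent.
  obtain ⟨V, hV, h⟩ := exists_open_forall (x := genericPoint X)
    (P := fun k y => c k ∈ regularFun y) (fun k => regularFun_open (mem_regularFun_genericPoint _))
  have hη : genericPoint X ∈ V ⊓ U := ⟨hV, hU⟩
  choose g hg using fun k => exists_germ_eq_of_regular hη (c k) (fun x hx => h x hx.1 k)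
  have h0 : toRat M hη (∑ k, g k • resSec M inf_le_right (e k)) = toRat M hη 0 := by
    rw [map_zero, map_sum, ← hc]
    refine Finset.sum_congr rfl fun k _ => ?_
    rw [toRat_smul, toRat_resSec, hg]
  obtain ⟨W, hWV, hW, h1⟩ := exists_resSec_eq hη h0
  rw [map_zero, map_sum] at h1
  have h2 := Fintype.linearIndependent_iff.1 (he W (hWV.trans inf_le_right)).1
    (fun k => (X.presheaf.map (homOfLE hWV).op).hom (g k)) (by
      rw [← h1]
      refine Finset.sum_congr rfl fun k _ => ?_
      rw [resSec_smul, resSec_resSec])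
  intro k
  rw [← hg k, ← TopCat.Presheaf.germ_res_apply' X.presheaf (homOfLE hWV).op _ hW (g k)]
  exact (congrArg _ (h2 k)).trans (map_zero (X.presheaf.germ W (genericPoint X) hW).hom)

theorem exists_toRat_eq_sum_of_frame (h : V ≤ U) (hV : genericPoint X ∈ V) (m : Γ(M, V)) :
    ∃ g : Fin n → Γ(X, V), ∑ k, g k • resSec M h (e k) = m ∧
      toRat M hV m = ∑ k, (X.presheaf.germ V (genericPoint X) hV (g k) : X.functionField) •
        toRat M (h hV) (e k) := by
  have hm : m ∈ Submodule.span Γ(X, V) (Set.range fun k => resSec M h (e k)) := by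
    rw [(he V h).2]; trivial
  obtain ⟨g, rfl⟩ := (Submodule.mem_span_range_iff_exists_fun _).1 hm
  refine ⟨g, rfl, ?_⟩
  rw [map_sum]
  refine Finset.sum_congr rfl fun k _ => ?_
  rw [toRat_smul, toRat_resSec]

theorem toRat_injective_of_frame (h : V ≤ U) (hV : genericPoint X ∈ V) :
    Function.Injective (toRat M hV) := by
  rw [injective_iff_map_eq_zero]
  intro m hm
  obtain ⟨g, rfl, hg⟩ := exists_toRat_eq_sum_of_frame he h hV m
  rw [hm] at hg
  have h2 := Fintype.linearIndependent_iff.1 (linearIndependent_toRat_of_frame he (h hV)) _ hg.symm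
  refine Finset.sum_eq_zero fun k _ => ?_
  have h3 : g k = 0 := germ_genericPoint_injective hV ((h2 k).trans
    (map_zero (X.presheaf.germ V (genericPoint X) hV).hom).symm)
  rw [h3, zero_smul]

theorem exists_basis_of_frame (hU : genericPoint X ∈ U) :
    ∃ b : Module.Basis (Fin n) X.functionField (RatSec M), ∀ x ∈ U, IsLocalBasis b x := by
  have hspan : ⊤ ≤ Submodule.span X.functionField (Set.range fun k => toRat M hU (e k)) := by
    rintro r -
    obtain ⟨V, hVU, hV, m, rfl⟩ := exists_toRat_eq hU r
    obtain ⟨g, -, hg⟩ := exists_toRat_eq_sum_of_frame he hVU hV m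
    rw [hg]
    exact sum_mem fun k _ => Submodule.smul_mem _ _ (Submodule.subset_span ⟨k, rfl⟩)
  let b := Module.Basis.mk (linearIndependent_toRat_of_frame he hU) hspan
  have hbk : ∀ k, b k = toRat M hU (e k) := fun k => Module.Basis.mk_apply _ _ k
  refine ⟨b, fun x hx r => ⟨?_, fun h => ?_⟩⟩
  · rintro ⟨V, hxV, m, rfl⟩ k
    have hη : genericPoint X ∈ V ⊓ U := ⟨genericPoint_mem hxV, hU⟩
    obtain ⟨g, -, hg⟩ := exists_toRat_eq_sum_of_frame he inf_le_right hη
      (resSec M (inf_le_left : V ⊓ U ≤ V) m)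
    rw [toRat_resSec] at hg
    rw [hg]
    simp only [← hbk]
    rw [b.repr_sum_self]
    exact germ_mem_regularFun (U := V ⊓ U) ⟨hxV, hx⟩ hη _
  · rw [← b.sum_repr r]
    refine sum_mem fun k _ => smul_mem_regularAt (h k) ?_
    rw [hbk]
    exact toRat_mem_regularAt hx (e k)

end Frame

theorem IsLocallyFreeOfRank.isTorsionFree {n : ℕ} (hM : IsLocallyFreeOfRank M n) :
    IsTorsionFree M := by
  intro U hU m m' h
  refine eq_of_locally_eq fun x hx => ?_
  obtain ⟨V, hxV, e, he⟩ := hM x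
  have hη : genericPoint X ∈ U ⊓ V := ⟨hU, genericPoint_mem hxV⟩
  refine ⟨U ⊓ V, inf_le_left, ⟨hx, hxV⟩, toRat_injective_of_frame he inf_le_right hη ?_⟩
  rw [toRat_resSec, toRat_resSec, h]

theorem IsLocallyFreeOfRank.exists_basis {n : ℕ} (hM : IsLocallyFreeOfRank M n) (x : X) :
    ∃ (b : Module.Basis (Fin n) X.functionField (RatSec M)) (U : X.Opens), x ∈ U ∧
      ∀ y ∈ U, IsLocalBasis b y := by
  obtain ⟨U, hx, e, he⟩ := hM x
  obtain ⟨b, hb⟩ := exists_basis_of_frame he (genericPoint_mem hx)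
  exact ⟨b, U, hx, hb⟩

theorem IsLocallyFreeOfRank.finrank_eq {n : ℕ} (hM : IsLocallyFreeOfRank M n) :
    Module.finrank X.functionField (RatSec M) = n := by
  obtain ⟨b, -⟩ := hM.exists_basis (genericPoint X)
  rw [Module.finrank_eq_card_basis b, Fintype.card_fin]

/-- Converse of `IsLocallyFreeOfRank.exists_basis`: the basis vectors are sections over `U`, and the
coordinates of a section over `V` are regular on `V`, hence functions on `V`. Local freeness becomes
a statement about stalks inside `Rat(M)`. -/
theorem IsTorsionFree.isLocallyFreeOfRank {n : ℕ} (hM : IsTorsionFree M)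
    (h : ∀ x : X, ∃ (b : Module.Basis (Fin n) X.functionField (RatSec M)) (U : X.Opens), x ∈ U ∧
      ∀ y ∈ U, IsLocalBasis b y) : IsLocallyFreeOfRank M n := by
  intro x
  obtain ⟨b, U, hx, hb⟩ := h x
  choose e he using fun k => hM.exists_toRat_eq (genericPoint_mem hx) (b k)
    (fun y hy => (hb y hy).mem k)
  refine ⟨U, hx, e, fun V hVU => ?_⟩
  by_cases hV : genericPoint X ∈ V
  · constructor
    · rw [Fintype.linearIndependent_iff]
      intro g hg k
      have h0 := congrArg (toRat M hV) hg
      rw [map_zero, map_sum] at h0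
      simp only [toRat_smul, toRat_resSec, he] at h0
      have := Fintype.linearIndependent_iff.1 b.linearIndependent _ h0 k
      exact germ_genericPoint_injective hV (this.trans
        (map_zero (X.presheaf.germ V (genericPoint X) hV).hom).symm)
    · rw [eq_top_iff]
      rintro m -
      choose g hg using fun k => exists_germ_eq_of_regular hV (b.repr (toRat M hV m) k)
        (fun y hy => (hb y (hVU hy) _).1 (toRat_mem_regularAt hy m) k)
      rw [Submodule.mem_span_range_iff_exists_fun]
      refine ⟨g, hM V hV ?_⟩
      rw [map_sum]
      simp only [toRat_smul, toRat_resSec, he, hg]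
      exact b.sum_repr _
  -- An open set without the generic point is empty; over the zero ring every family is a basis.
  · have := subsingleton_sections (M := M) hV
    refine ⟨?_, Subsingleton.elim _ _⟩
    have hbot : V = ⊥ := by
      ext y
      exact ⟨fun hy => (hV (genericPoint_mem hy)).elim, fun hy => hy.elim⟩
    have : Subsingleton Γ(X, V) := by
      subst hbot
      exact inferInstance
    exact linearIndependent_of_subsingleton

end LocallyFree

/-! ### Rational and regular homomorphisms -/

section RegularHom

variable {X : Scheme.{0}} {E F W : X.Modules} {U V : X.Opens}

theorem HomSections.ext {φ ψ : HomSections F E U}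
    (h : ∀ (V : {V : X.Opens // V ≤ U}) (f : Γ(F, V.1)), φ.1 V f = ψ.1 V f) : φ = ψ :=
  Subtype.ext (funext fun V => LinearMap.ext (h V))

variable [IsIntegral X]

theorem Induces.mem {φ : HomSections F E U} {β : RatHom F E} (h : Induces φ β) {x : X} (hx : x ∈ U)
    {f : RatSec F} (hf : f ∈ regularAt F x) : β f ∈ regularAt E x := by
  obtain ⟨V, hxV, m, rfl⟩ := hf
  refine ⟨V ⊓ U, ⟨hxV, hx⟩, φ.1 ⟨V ⊓ U, inf_le_right⟩ (resSec F inf_le_left m), ?_⟩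
  have hη : genericPoint X ∈ V ⊓ U := ⟨genericPoint_mem hxV, genericPoint_mem hx⟩
  rw [h ⟨V ⊓ U, inf_le_right⟩ hη, toRat_resSec]

theorem Induces.res {φ : HomSections F E U} {β : RatHom F E} (h : Induces φ β) (hVU : V ≤ U) :
    Induces (HomSections.res hVU φ) β :=
  fun V' hη f => h ⟨V'.1, V'.2.trans hVU⟩ hη f

theorem Induces.add {φ φ' : HomSections F E U} {β β' : RatHom F E} (h : Induces φ β)
    (h' : Induces φ' β') : Induces (φ + φ') (β + β') := by
  intro V hη f
  rw [LinearMap.add_apply, ← h V hη f, ← h' V hη f, ← map_add]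
  rfl

theorem Induces.sub {φ φ' : HomSections F E U} {β β' : RatHom F E} (h : Induces φ β)
    (h' : Induces φ' β') : Induces (φ - φ') (β - β') := by
  intro V hη f
  rw [LinearMap.sub_apply, ← h V hη f, ← h' V hη f, ← map_sub]
  rfl

theorem Induces.eq_right {φ : HomSections F E U} {β β' : RatHom F E} (hU : genericPoint X ∈ U)
    (h : Induces φ β) (h' : Induces φ β') : β = β' := by
  ext r
  obtain ⟨V, hVU, hV, m, rfl⟩ := exists_toRat_eq hU r
  rw [← h ⟨V, hVU⟩ hV, h' ⟨V, hVU⟩ hV]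

theorem Induces.eq_left (hE : IsTorsionFree E) {φ φ' : HomSections F E U} {β : RatHom F E}
    (h : Induces φ β) (h' : Induces φ' β) : φ = φ' := by
  refine HomSections.ext fun V f => ?_
  by_cases hV : genericPoint X ∈ V.1
  · exact hE V.1 hV (by rw [h V hV, h' V hV])
  · have := subsingleton_sections (M := E) hV
    exact Subsingleton.elim _ _

/-- A section of `Hom(F, E)` over a nonempty open set defines a rational section. -/
theorem HomSections.exists_induces (φ : HomSections F E U) (hU : genericPoint X ∈ U) :
    ∃ β : RatHom F E, Induces φ β := by
  -- The value at `r` is computed from a chosen representative `m r`; by `key` any other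
  -- representative gives the same value, because the two agree on a smaller open set.
  choose V hVU hV m hm using fun r : RatSec F => exists_toRat_eq hU r
  have key : ∀ (V' : {V : X.Opens // V ≤ U}) (h : genericPoint X ∈ V'.1) (f : Γ(F, V'.1)),
      toRat E h (φ.1 V' f) = toRat E (hV (toRat F h f)) (φ.1 ⟨_, hVU _⟩ (m (toRat F h f))) := by
    intro V' h f
    set r := toRat F h f with hr
    have hη : genericPoint X ∈ V'.1 ⊓ V r := ⟨h, hV r⟩
    have h1 : toRat F hη (resSec F inf_le_left f) = toRat F hη (resSec F inf_le_right (m r)) := by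
      rw [toRat_resSec, toRat_resSec, hm]
    obtain ⟨W, hW, hWη, h2⟩ := exists_resSec_eq hη h1
    rw [resSec_resSec, resSec_resSec] at h2
    have hWU : W ≤ U := hW.trans (inf_le_left.trans V'.2)
    have h3 := φ.2 V' ⟨W, hWU⟩ (hW.trans inf_le_left) f
    have h4 := φ.2 ⟨V r, hVU r⟩ ⟨W, hWU⟩ (hW.trans inf_le_right) (m r)
    rw [← toRat_resSec (hW.trans inf_le_left) hWη, h3, h2, ← h4, toRat_resSec]
  refine ⟨{ toFun := fun r => toRat E (hV r) (φ.1 ⟨V r, hVU r⟩ (m r)), map_add' := ?_,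
            map_smul' := ?_ }, key⟩
  · intro r r'
    have hη : genericPoint X ∈ V r ⊓ V r' := ⟨hV r, hV r'⟩
    have e : r + r' = toRat F hη (resSec F inf_le_left (m r) + resSec F inf_le_right (m r')) := by
      rw [map_add, toRat_resSec, toRat_resSec, hm, hm]
    have h1 := key ⟨V r ⊓ V r', inf_le_left.trans (hVU r)⟩ hη
      (resSec F inf_le_left (m r) + resSec F inf_le_right (m r'))
    rw [← e] at h1
    rw [← h1, map_add, map_add, ← φ.2 ⟨V r, hVU r⟩ ⟨_, _⟩, ← φ.2 ⟨V r', hVU r'⟩ ⟨_, _⟩,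
      toRat_resSec, toRat_resSec]
  · intro c r
    obtain ⟨W, hWV, hW, g, rfl⟩ := exists_germ_eq_le (hV r) c
    have e : (X.presheaf.germ W (genericPoint X) hW g : X.functionField) • r =
        toRat F hW (g • resSec F hWV (m r)) := by
      rw [toRat_smul, toRat_resSec, hm]
    have h1 := key ⟨W, hWV.trans (hVU r)⟩ hW (g • resSec F hWV (m r))
    rw [← e] at h1
    rw [← h1, map_smul, toRat_smul, ← φ.2 ⟨V r, hVU r⟩ ⟨_, _⟩, toRat_resSec, RingHom.id_apply]

/-- A rational homomorphism that is regular on `U` is a section of `Hom(F, E)` over `U`. -/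
theorem IsTorsionFree.exists_induces (hE : IsTorsionFree E) (β : RatHom F E)
    (h : ∀ x ∈ U, ∀ f ∈ regularAt F x, β f ∈ regularAt E x) :
    ∃ φ : HomSections F E U, Induces φ β := by
  have key : ∀ (V : {V : X.Opens // V ≤ U}), ∃ ψ : Γ(F, V.1) →ₗ[Γ(X, V.1)] Γ(E, V.1),
      ∀ (hV : genericPoint X ∈ V.1) (f : Γ(F, V.1)), toRat E hV (ψ f) = β (toRat F hV f) := by
    intro V
    by_cases hV : genericPoint X ∈ V.1
    · choose ψ hψ using fun f : Γ(F, V.1) => hE.exists_toRat_eq hV (β (toRat F hV f))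
        (fun x hx => h x (V.2 hx) _ (toRat_mem_regularAt hx f))
      refine ⟨{ toFun := ψ, map_add' := fun f g => hE _ hV ?_, map_smul' := fun c f => hE _ hV ?_ },
        fun _ => hψ⟩
      · rw [map_add, hψ, hψ, hψ, map_add, map_add]
      · rw [hψ, toRat_smul, map_smul, RingHom.id_apply, toRat_smul, hψ]
    · exact ⟨0, fun h => (hV h).elim⟩
  choose ψ hψ using key
  refine ⟨⟨ψ, fun V V' hVV' f => ?_⟩, fun V hV f => hψ V hV f⟩
  by_cases hV : genericPoint X ∈ V'.1
  · refine hE _ hV ?_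
    rw [toRat_resSec, hψ, hψ, toRat_resSec]
  · have := subsingleton_sections (M := E) hV
    exact Subsingleton.elim _ _

/-- Only the finitely many images of the basis vectors have to stay regular. -/
theorem preserves_open {ι : Type*} [Finite ι] {b : Module.Basis ι X.functionField (RatSec F)}
    {x : X} (hx : x ∈ U) (hb : ∀ y ∈ U, IsLocalBasis b y) (β : RatHom F E)
    (h : ∀ f ∈ regularAt F x, β f ∈ regularAt E x) :
    ∃ V : X.Opens, x ∈ V ∧ V ≤ U ∧ ∀ y ∈ V, ∀ f ∈ regularAt F y, β f ∈ regularAt E y := by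
  cases nonempty_fintype ι
  obtain ⟨V, hxV, hV⟩ := exists_open_forall (x := x) (P := fun k y => β (b k) ∈ regularAt E y)
    (fun k => regularAt_open (h _ ((hb x hx).mem k)))
  refine ⟨V ⊓ U, ⟨hxV, hx⟩, inf_le_right, fun y hy f hf => ?_⟩
  rw [← b.sum_repr f, map_sum]
  refine sum_mem fun k _ => ?_
  rw [map_smul]
  exact smul_mem_regularAt ((hb y hy.2 f).1 hf k) (hV y hy.1 k)

theorem IsLocallyFreeOfRank.preserves_open {n : ℕ} (hF : IsLocallyFreeOfRank F n) {x : X}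
    (β : RatHom F E) (h : ∀ f ∈ regularAt F x, β f ∈ regularAt E x) :
    ∃ V : X.Opens, x ∈ V ∧ ∀ y ∈ V, ∀ f ∈ regularAt F y, β f ∈ regularAt E y := by
  obtain ⟨b, U, hx, hb⟩ := hF.exists_basis x
  obtain ⟨V, hxV, -, hV⟩ := CurveExt.preserves_open hx hb β h
  exact ⟨V, hxV, hV⟩

/-- A rational homomorphism is regular at `x` if and only if it maps `F_x` to `E_x`. -/
theorem mem_homRegularAt_iff {n : ℕ} (hF : IsLocallyFreeOfRank F n) (hE : IsTorsionFree E) {x : X}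
    {β : RatHom F E} :
    β ∈ homRegularAt F E x ↔ ∀ f ∈ regularAt F x, β f ∈ regularAt E x := by
  constructor
  · rintro ⟨U, hx, φ, hφ⟩ f hf
    exact hφ.mem hx hf
  · intro h
    obtain ⟨V, hxV, hV⟩ := hF.preserves_open β h
    obtain ⟨φ, hφ⟩ := hE.exists_induces β hV
    exact ⟨V, hxV, φ, hφ⟩

/-- If `Hom(F, E)` has no global sections, a rational homomorphism that is regular everywhere
vanishes. -/
theorem IsTorsionFree.eq_zero_of_regular (hE : IsTorsionFree E)
    (h0 : Subsingleton (HomSections F E ⊤)) (β : RatHom F E)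
    (h : ∀ x, ∀ f ∈ regularAt F x, β f ∈ regularAt E x) : β = 0 := by
  obtain ⟨φ, hφ⟩ := hE.exists_induces (U := ⊤) β (fun x _ => h x)
  refine Induces.eq_right (U := ⊤) trivial hφ (β' := 0) ?_
  rw [Subsingleton.elim φ 0]
  exact fun V hV f => map_zero (toRat E hV)

end RegularHom

/-! ### Extensions -/

section Extensions

variable {X : Scheme.{0}} [IsIntegral X] {A B C : X.Modules} {i : A ⟶ B} {p : B ⟶ C} {w : i ≫ p = 0}

/-- A section of `B` that comes rationally from `A` dies in `Rat(C)`, hence in the torsion-free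
sheaf `C`, and so comes from a section of `A`. -/
theorem ratLin_mem_regularAt_iff [Mono i] (hS : (ShortComplex.mk i p w).Exact)
    (hC : IsTorsionFree C) {x : X} {a : RatSec A} :
    ratLin i a ∈ regularAt B x ↔ a ∈ regularAt A x := by
  refine ⟨?_, ratLin_mem_regularAt i⟩
  rintro ⟨U, hx, m, hm⟩
  have h0 : appLin p U m = 0 := hC U (genericPoint_mem hx) (by
    rw [← ratLin_toRat, hm, map_zero, ratLin_comp_eq_zero w])
  obtain ⟨l, rfl⟩ := exists_appLin_eq_of_exact hS m h0
  rw [← ratLin_toRat] at hm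
  rw [← ratLin_injective i hm]
  exact toRat_mem_regularAt hx l

theorem isTorsionFree_of_exact [Mono i] (hS : (ShortComplex.mk i p w).Exact)
    (hA : IsTorsionFree A) (hC : IsTorsionFree C) : IsTorsionFree B := by
  intro U hU
  rw [injective_iff_map_eq_zero]
  intro m hm
  have h0 : appLin p U m = 0 := hC U hU (by rw [← ratLin_toRat, hm, map_zero, map_zero])
  obtain ⟨l, rfl⟩ := exists_appLin_eq_of_exact hS m h0
  rw [← ratLin_toRat, ← map_zero (ratLin i)] at hm
  rw [hA U hU ((ratLin_injective i hm).trans (map_zero _).symm), map_zero]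

/-- Over the field `K(X)` the injection `ratLin i` has a linear left inverse; composing `φ` with it
gives the lift. -/
theorem exists_lift_of_exact [Mono i] (hS : (ShortComplex.mk i p w).Exact) {F : X.Modules}
    (φ : RatHom F B) (h : ∀ r, ratLin p (φ r) = 0) : ∃ β : RatHom F A, ∀ r, ratLin i (β r) = φ r := by
  obtain ⟨g, hg⟩ := LinearMap.exists_leftInverse_of_injective (ratLin i)
    (LinearMap.ker_eq_bot.2 (ratLin_injective i))
  refine ⟨g ∘ₗ φ, fun r => ?_⟩
  obtain ⟨a, ha⟩ := exists_ratLin_eq_of_exact hS (φ r) (h r)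
  rw [LinearMap.comp_apply, ← ha]
  exact congrArg (ratLin i) (LinearMap.congr_fun hg a)

/-- An extension of a locally free sheaf splits locally. -/
theorem exists_local_splitting [Epi p] {n : ℕ} (hC : IsLocallyFreeOfRank C n) (x : X) :
    ∃ σ : RatHom C B, (∀ r, ratLin p (σ r) = r) ∧
      ∃ U : X.Opens, x ∈ U ∧ ∀ y ∈ U, ∀ f ∈ regularAt C y, σ f ∈ regularAt B y := by
  obtain ⟨b, U, hx, hb⟩ := hC.exists_basis x
  choose l hl hpl using fun k => exists_ratLin_eq_of_epi p ((hb x hx).mem k)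
  let σ : RatHom C B := b.constr X.functionField l
  have hσ : ∀ k, σ (b k) = l k := fun k => b.constr_basis _ _ _
  refine ⟨σ, fun r => ?_, ?_⟩
  · have : ratLin p ∘ₗ σ = LinearMap.id := b.ext fun k => by
      rw [LinearMap.comp_apply, hσ, hpl, LinearMap.id_apply]
    exact LinearMap.congr_fun this r
  · obtain ⟨V, hxV, -, hV⟩ := preserves_open hx hb σ (fun f hf => by
      rw [← b.sum_repr f, map_sum]
      refine sum_mem fun k _ => ?_
      rw [map_smul, hσ]
      exact smul_mem_regularAt ((hb x hx f).1 hf k) (hl k))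
    exact ⟨V, hxV, hV⟩

/-- An extension of locally free sheaves is locally free. -/
theorem isLocallyFreeOfRank_of_exact [Mono i] [Epi p] (hS : (ShortComplex.mk i p w).Exact)
    {m n : ℕ} (hA : IsLocallyFreeOfRank A m) (hC : IsLocallyFreeOfRank C n) :
    IsLocallyFreeOfRank B (m + n) := by
  refine (isTorsionFree_of_exact hS hA.isTorsionFree hC.isTorsionFree).isLocallyFreeOfRank ?_
  intro x
  obtain ⟨bA, U, hxU, hbA⟩ := hA.exists_basis x
  obtain ⟨bC, V, hxV, hbC⟩ := hC.exists_basis x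
  obtain ⟨σ, hσ, V', hxV', hV'⟩ := exists_local_splitting (p := p) hC x
  -- Rationally `B` is the direct sum of `A` and `σ(C)`; `h1` below shows that near `x` the stalks
  -- decompose in the same way.
  have hsur : Function.Bijective ((ratLin i).coprod σ) := by
    constructor
    · rw [← LinearMap.ker_eq_bot, eq_bot_iff]
      rintro ⟨a, c⟩ h
      rw [LinearMap.mem_ker, LinearMap.coprod_apply] at h
      have hc := congrArg (ratLin p) h
      rw [map_add, ratLin_comp_eq_zero w, zero_add, hσ, map_zero] at hc
      change c = 0 at hc
      subst hc
      rw [map_zero, add_zero, ← map_zero (ratLin i)] at h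
      have ha : a = 0 := ratLin_injective i h
      rw [ha]
      exact zero_mem _
    · intro r
      obtain ⟨a, ha⟩ := exists_ratLin_eq_of_exact hS (r - σ (ratLin p r)) (by
        rw [map_sub, hσ, sub_self])
      exact ⟨(a, ratLin p r), by rw [LinearMap.coprod_apply, ha, sub_add_cancel]⟩
  let e := LinearEquiv.ofBijective _ hsur
  refine ⟨((bA.prod bC).map e).reindex finSumFinEquiv, U ⊓ (V ⊓ V'), ⟨hxU, hxV, hxV'⟩,
    fun y hy => IsLocalBasis.reindex (fun r => ?_) _⟩
  obtain ⟨⟨a, c⟩, rfl⟩ := e.surjective r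
  have hac : e (a, c) = ratLin i a + σ c := rfl
  have h1 : e (a, c) ∈ regularAt B y ↔ a ∈ regularAt A y ∧ c ∈ regularAt C y := by
    rw [hac]
    constructor
    · intro h
      have hc := ratLin_mem_regularAt p h
      rw [map_add, ratLin_comp_eq_zero w, zero_add, hσ] at hc
      refine ⟨(ratLin_mem_regularAt_iff hS hC.isTorsionFree).1 ?_, hc⟩
      have := sub_mem h (hV' y hy.2.2 c hc)
      rwa [add_sub_cancel_right] at this
    · rintro ⟨ha, hc⟩
      exact add_mem (ratLin_mem_regularAt i ha) (hV' y hy.2.2 c hc)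
  rw [h1, hbA y hy.1 a, hbC y hy.2.1 c]
  simp only [Module.Basis.map_repr, LinearEquiv.trans_apply, e.symm_apply_apply, Sum.forall,
    Module.Basis.prod_repr_inl, Module.Basis.prod_repr_inr]

end Extensions

/-! ### Saturated sublattices -/

section Lattices

open Module

/-- A lattice over a principal ideal domain has a basis that is adapted to a given subspace. -/
theorem exists_adapted_basis (R : Type*) {K V ι : Type*} [CommRing R] [IsDomain R]
    [IsPrincipalIdealRing R] [Field K] [Algebra R K] [IsFractionRing R K] [AddCommGroup V]
    [Module K V] [Finite ι] (b : Basis ι K V) (S : Submodule K V) :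
    ∃ (a c : ℕ) (w : Basis (Fin a ⊕ Fin c) K V),
      (∀ r, (∀ k, b.repr r k ∈ (algebraMap R K).range) ↔
        ∀ k, w.repr r k ∈ (algebraMap R K).range) ∧
      ∀ r, r ∈ S ↔ ∀ k, w.repr r (Sum.inr k) = 0 := by
  cases nonempty_fintype ι
  let : Module R V := Module.compHom V (algebraMap R K)
  have : IsScalarTower R K V := .of_algebraMap_smul fun _ _ => rfl
  let L : Submodule R V := Submodule.span R (Set.range b)
  let bL : Basis ι R L := b.restrictScalars R
  have : Module.Free R L := Module.Free.of_basis bL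
  have : Module.Finite R L := Module.Finite.of_basis bL
  -- `N = L ∩ S`. As `S` is a `K`-subspace, `L / N` is torsion-free, hence free, so a basis of `N`
  -- extends to one of `L`.
  let N : Submodule R L := (S.restrictScalars R).comap L.subtype
  have hNS : ∀ l : L, l ∈ N ↔ (l : V) ∈ S := fun l => Iff.rfl
  have htf : Module.IsTorsionFree R (L ⧸ N) := by
    refine Module.IsTorsionFree.of_smul_eq_zero fun d l hl => ?_
    obtain ⟨l, rfl⟩ := N.mkQ_surjective l
    by_contra! hne
    rw [← map_smul, N.mkQ_apply, Submodule.Quotient.mk_eq_zero, hNS] at hl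
    refine hne.2 ((Submodule.Quotient.mk_eq_zero N).2 ?_)
    have hd : algebraMap R K d ≠ 0 := fun h0 => hne.1 ((map_eq_zero_iff _
      (IsFractionRing.injective R K)).1 h0)
    exact (S.smul_mem_iff hd).1 hl
  have : Module.Free R (L ⧸ N) := Module.free_of_finite_type_torsion_free'
  let bN := Module.finBasis R N
  let bQ := Module.finBasis R (L ⧸ N)
  let u := bN.sumQuot bQ
  have hu : ∀ l : L, (l : V) = ∑ k, algebraMap R K (u.repr l k) • (u k : V) := fun l => by
    conv_lhs => rw [← u.sum_repr l]
    rw [Submodule.coe_sum]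
    rfl
  have hli : LinearIndependent K (fun k => (u k : V)) :=
    (LinearIndependent.iff_fractionRing R K).1
      (u.linearIndependent.map' L.subtype (Submodule.ker_subtype L))
  have hspan : ⊤ ≤ Submodule.span K (Set.range fun k => (u k : V)) := by
    rw [← b.span_eq, Submodule.span_le]
    rintro _ ⟨k, rfl⟩
    change ((⟨b k, Submodule.subset_span ⟨k, rfl⟩⟩ : L) : V) ∈ _
    rw [hu]
    exact sum_mem fun l _ => Submodule.smul_mem _ _ (Submodule.subset_span ⟨l, rfl⟩)
  let w := Basis.mk hli hspan
  have hw : ∀ k, w k = (u k : V) := fun k => Basis.mk_apply _ _ k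
  have hrepr : ∀ (l : L) k, w.repr l k = algebraMap R K (u.repr l k) := by
    intro l k
    conv_lhs => rw [hu l]
    simp only [← hw]
    rw [w.repr_sum_self]
  have hLb : ∀ r, (∀ k, b.repr r k ∈ (algebraMap R K).range) ↔ r ∈ L := fun r =>
    (b.mem_span_iff_repr_mem R r).symm
  have hLw : ∀ r, (∀ k, w.repr r k ∈ (algebraMap R K).range) ↔ r ∈ L := by
    intro r
    constructor
    · intro h
      rw [← w.sum_repr r]
      refine sum_mem fun k _ => ?_
      obtain ⟨d, hd⟩ := h k
      rw [← hd, hw]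
      exact L.smul_mem d (u k).2
    · intro h k
      exact ⟨_, (hrepr ⟨r, h⟩ k).symm⟩
  refine ⟨_, _, w, fun r => (hLb r).trans (hLw r).symm, fun r => ⟨fun hr k => ?_, fun hr => ?_⟩⟩
  -- A common denominator `d` moves `r` into `L`, hence into `N`, where the coordinates along the
  -- basis of `L / N` vanish.
  · obtain ⟨d, hd⟩ := IsLocalization.exist_integer_multiples_of_finite (nonZeroDivisors R)
      (fun k => w.repr r k)
    have hd0 : algebraMap R K d ≠ 0 := IsFractionRing.to_map_ne_zero_of_mem_nonZeroDivisors d.2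
    have hrL : algebraMap R K d • r ∈ L := (hLw _).1 fun k => by
      obtain ⟨e, he⟩ := hd k
      refine ⟨e, ?_⟩
      rw [he, map_smul, Finsupp.smul_apply, Algebra.smul_def, smul_eq_mul]
    have hN : (⟨_, hrL⟩ : L) ∈ N := (hNS _).2 (S.smul_mem _ hr)
    have h1 := congrArg N.mkQ (u.sum_repr ⟨_, hrL⟩)
    rw [N.mkQ_apply ⟨_, hrL⟩, (Submodule.Quotient.mk_eq_zero N).2 hN, Fintype.sum_sum_type, map_add,
      map_sum, map_sum, Finset.sum_eq_zero, zero_add] at h1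
    · have h2 : ∑ k, u.repr ⟨_, hrL⟩ (Sum.inr k) • bQ k = 0 := by
        rw [← h1]
        refine Finset.sum_congr rfl fun k _ => ?_
        rw [map_smul]
        congr 1
        exact (Basis.sumQuot_inr bN bQ k).symm
      have h3 := Fintype.linearIndependent_iff.1 bQ.linearIndependent _ h2 k
      have h4 := hrepr ⟨_, hrL⟩ (Sum.inr k)
      rw [h3, map_zero] at h4
      change w.repr (algebraMap R K d • r) (Sum.inr k) = 0 at h4
      rw [map_smul, Finsupp.smul_apply, smul_eq_mul] at h4
      exact (mul_eq_zero.1 h4).resolve_left hd0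
    · intro k _
      rw [map_smul, N.mkQ_apply, (Submodule.Quotient.mk_eq_zero N).2, smul_zero]
      rw [Basis.sumQuot_inl]
      exact (bN k).2
  · rw [← w.sum_repr r, Fintype.sum_sum_type]
    refine add_mem (sum_mem fun k _ => S.smul_mem _ ?_) (sum_mem fun k _ => ?_)
    · rw [hw, ← hNS]
      have : u (Sum.inl k) = bN k := Basis.sumQuot_inl bN bQ k
      rw [this]
      exact (bN k).2
    · rw [hr k, zero_smul]
      exact zero_mem _

end Lattices

/-! ### The saturated subsheaf defined by a rational splitting -/

theorem exists_equiv_of_ker_eq {K V A B : Type*} [Field K] [AddCommGroup V] [Module K V]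
    [AddCommGroup A] [Module K A] [AddCommGroup B] [Module K B] (f : V →ₗ[K] A) (g : V →ₗ[K] B)
    (hf : Function.Surjective f) (hg : Function.Surjective g) (h : ∀ v, f v = 0 ↔ g v = 0) :
    ∃ e : A ≃ₗ[K] B, ∀ v, e (f v) = g v := by
  have hker : LinearMap.ker f = LinearMap.ker g := by
    ext v
    exact h v
  refine ⟨(f.quotKerEquivOfSurjective hf).symm ≪≫ₗ Submodule.quotEquivOfEq _ _ hker ≪≫ₗ
    g.quotKerEquivOfSurjective hg, fun v => ?_⟩
  have : (f.quotKerEquivOfSurjective hf).symm (f v) = Submodule.Quotient.mk v := by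
    rw [LinearEquiv.symm_apply_eq]
    rfl
  simp only [LinearEquiv.trans_apply, this]
  rfl

section Saturated

variable {X : Scheme.{0}} [IsIntegral X] {W F K : X.Modules} {π : W ⟶ F} {s : RatHom F W}

/-- A basis of `W_x` adapted to the range of `s` stays a local basis nearby, and the condition on
the range does not involve the point. -/
theorem exists_adapted_local_basis (hP : ∀ x : X, IsPrincipalIdealRing (X.presheaf.stalk x)) {N : ℕ}
    (hW : IsLocallyFreeOfRank W N) (s : RatHom F W) (x : X) :
    ∃ (a c : ℕ) (w : Module.Basis (Fin a ⊕ Fin c) X.functionField (RatSec W)) (U : X.Opens),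
      x ∈ U ∧ (∀ y ∈ U, IsLocalBasis w y) ∧
        ∀ r, r ∈ LinearMap.range s ↔ ∀ k, w.repr r (Sum.inr k) = 0 := by
  obtain ⟨b, U, hx, hb⟩ := hW.exists_basis x
  have := hP x
  obtain ⟨a, c, w, h1, h2⟩ := exists_adapted_basis (X.presheaf.stalk x) b (LinearMap.range s)
  obtain ⟨V, hxV, -, hV⟩ := IsLocalBasis.spread hx hb (b' := w) (fun r => (hb x hx r).trans (h1 r))
  exact ⟨a, c, w, V, hxV, hV, h2⟩

/-- The vectors `w (Sum.inl k)` form a basis of the range of `s`, which `s` identifies with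
`Rat(F)`. -/
theorem exists_basis_of_adapted (hs : Function.Injective s) {a c : ℕ}
    (w : Module.Basis (Fin a ⊕ Fin c) X.functionField (RatSec W))
    (hw : ∀ r, r ∈ LinearMap.range s ↔ ∀ k, w.repr r (Sum.inr k) = 0) :
    ∃ b : Module.Basis (Fin a) X.functionField (RatSec F),
      ∀ f k, b.repr f k = w.repr (s f) (Sum.inl k) := by
  let g : RatSec F →ₗ[X.functionField] (Fin a → X.functionField) :=
    LinearMap.pi fun k => Finsupp.lapply (Sum.inl k) ∘ₗ w.repr.toLinearMap ∘ₗ s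
  have hg : ∀ f k, g f k = w.repr (s f) (Sum.inl k) := fun _ _ => rfl
  have hbij : Function.Bijective g := by
    constructor
    · rw [← LinearMap.ker_eq_bot, eq_bot_iff]
      intro f hf
      have h0 : s f = 0 := by
        rw [← w.sum_repr (s f), Fintype.sum_sum_type]
        simp only [← hg, (hw (s f)).1 ⟨f, rfl⟩, LinearMap.mem_ker.1 hf, Pi.zero_apply, zero_smul,
          Finset.sum_const_zero, add_zero]
      exact hs (h0.trans (map_zero s).symm)
    · intro d
      have hr : ∀ l, w.repr (∑ k, d k • w (Sum.inl k)) l = Sum.elim d 0 l := by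
        intro l
        have : ∑ k, d k • w (Sum.inl k) = ∑ k, (Sum.elim d 0 : _ → X.functionField) k • w k := by
          rw [Fintype.sum_sum_type]
          simp
        rw [this, w.repr_sum_self]
      obtain ⟨f, hf⟩ := (hw (∑ k, d k • w (Sum.inl k))).2 fun k => hr _
      refine ⟨f, funext fun k => ?_⟩
      rw [hg, hf, hr]
      rfl
  exact ⟨Module.Basis.ofEquivFun (LinearEquiv.ofBijective g hbij), fun f k => rfl⟩

variable (hs : ∀ f, ratLin π (s f) = f) (k : K ⟶ F) (j : K ⟶ W) (hjk : j ≫ π = k)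
  (hsj : ∀ r, s (ratLin k r) = ratLin j r)
  (hrange : ∀ (U : X.Opens) (f : Γ(F, U)), f ∈ LinearMap.range (appLin k U) ↔
    ∀ (x : X) (hx : x ∈ U), s (toRat F (genericPoint_mem hx) f) ∈ regularAt W x)

theorem isTorsionFree_of_mono [Mono k] (hF : IsTorsionFree F) : IsTorsionFree K := by
  intro U hU
  rw [injective_iff_map_eq_zero]
  intro m hm
  refine appLin_injective k U (hF U hU ?_)
  rw [← ratLin_toRat, hm, map_zero, map_zero, map_zero]

include hs hsj hrange

/-- If `s (k r)` is regular at `x`, so is `k r = π (s (k r))`. Both remain regular near `x`, where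
`hrange` makes `k r` a section of `K`. -/
theorem mem_regularAt_iff_of_saturated [Mono k] {x : X} {r : RatSec K} :
    r ∈ regularAt K x ↔ s (ratLin k r) ∈ regularAt W x := by
  constructor
  · intro h
    rw [hsj]
    exact ratLin_mem_regularAt j h
  · intro h
    have hf : ratLin k r ∈ regularAt F x := by
      rw [← hs (ratLin k r)]
      exact ratLin_mem_regularAt π h
    obtain ⟨U, hx, f, hf⟩ := hf
    obtain ⟨V, hxV, hV⟩ := regularAt_open h
    have hη : genericPoint X ∈ U ⊓ V := ⟨genericPoint_mem hx, genericPoint_mem hxV⟩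
    obtain ⟨m, hm⟩ := (hrange (U ⊓ V) (resSec F inf_le_left f)).2 fun y hy => by
      rw [toRat_resSec, hf]
      exact hV y hy.2
    have : toRat K hη m = r := ratLin_injective k (by rw [ratLin_toRat, hm, toRat_resSec, hf])
    rw [← this]
    exact toRat_mem_regularAt (U := U ⊓ V) ⟨hx, hxV⟩ m

omit hs hsj in
-- For each `f`, the rational section `s f` is regular near the generic point, so `f` belongs to `K`
-- there.
theorem ratLin_bijective_of_saturated [Mono k] : Function.Bijective (ratLin k) := by
  refine ⟨ratLin_injective k, fun r => ?_⟩
  obtain ⟨U, -, hU, f, rfl⟩ := exists_toRat_eq (U := ⊤) trivial r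
  obtain ⟨V, hV, h⟩ := regularAt_open (mem_regularAt_genericPoint (s (toRat F hU f)))
  have hη : genericPoint X ∈ U ⊓ V := ⟨hU, hV⟩
  obtain ⟨m, hm⟩ := (hrange (U ⊓ V) (resSec F inf_le_left f)).2 fun y hy => by
    rw [toRat_resSec]
    exact h y hy.2
  exact ⟨toRat K hη m, by rw [ratLin_toRat, hm, toRat_resSec]⟩

/-- The first block of an adapted basis of `W_x`, pulled back along `s`, is a local basis of `K`;
its length is `n` by comparison with `Rat(F)`. -/
theorem isLocallyFreeOfRank_of_saturated [Mono k]
    (hP : ∀ x : X, IsPrincipalIdealRing (X.presheaf.stalk x)) {n N : ℕ}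
    (hF : IsLocallyFreeOfRank F n) (hW : IsLocallyFreeOfRank W N) : IsLocallyFreeOfRank K n := by
  have hsi : Function.Injective s := Function.LeftInverse.injective hs
  refine (isTorsionFree_of_mono k hF.isTorsionFree).isLocallyFreeOfRank fun x => ?_
  obtain ⟨a, c, w, U, hx, hU, hw⟩ := exists_adapted_local_basis hP hW s x
  obtain ⟨b, hb⟩ := exists_basis_of_adapted hsi w hw
  have ha : a = n := by rw [← hF.finrank_eq, Module.finrank_eq_card_basis b, Fintype.card_fin]
  subst ha
  let e := LinearEquiv.ofBijective (ratLin k) (ratLin_bijective_of_saturated k hrange)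
  refine ⟨b.map e.symm, U, hx, fun y hy r => ?_⟩
  rw [mem_regularAt_iff_of_saturated hs k j hsj hrange, hU y hy]
  have h1 : ∀ l, (b.map e.symm).repr r l = w.repr (s (ratLin k r)) (Sum.inl l) := fun l => by
    rw [← hb]
    rfl
  have h2 := (hw (s (ratLin k r))).1 ⟨_, rfl⟩
  simp only [h1, Sum.forall, h2, zero_mem, implies_true, and_true]

/-- Saturation: if a section of `W` equals `j l` for a rational `l`, then `s (k l) = j l` is
regular, so `l` is a section of `K`. -/
theorem isTorsionFree_cokernel_of_saturated [Mono k] [Mono j] (hF : IsTorsionFree F)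
    (hW : IsTorsionFree W) : IsTorsionFree (cokernel j) := by
  intro U hU
  rw [injective_iff_map_eq_zero]
  intro t ht
  refine eq_of_locally_eq fun x hx => ?_
  obtain ⟨V, hVU, hxV, m, hm⟩ := exists_appLin_eq_of_epi (cokernel.π j) hx t
  refine ⟨V, hVU, hxV, ?_⟩
  have hV := genericPoint_mem hxV
  rw [map_zero, ← hm]
  have h0 : ratLin (cokernel.π j) (toRat W hV m) = 0 := by
    rw [ratLin_toRat, hm, toRat_resSec, ht]
  obtain ⟨l, hl⟩ := exists_ratLin_eq_of_exact (ShortComplex.exact_cokernel j) _ h0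
  obtain ⟨l', rfl⟩ := (isTorsionFree_of_mono k hF).exists_toRat_eq hV l fun y hy => by
    rw [mem_regularAt_iff_of_saturated hs k j hsj hrange, hsj, hl]
    exact toRat_mem_regularAt hy m
  rw [ratLin_toRat] at hl
  rw [← hW V hV hl, ← appLin_comp, cokernel.condition]
  rfl

theorem isLocallyFree_cokernel_of_saturated [Mono k] [Mono j]
    (hP : ∀ x : X, IsPrincipalIdealRing (X.presheaf.stalk x)) {N : ℕ}
    (hF : IsTorsionFree F) (hW : IsLocallyFreeOfRank W N) :
    ∃ r, IsLocallyFreeOfRank (cokernel j) r := by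
  -- The number `c` comes from a basis chosen at `x`; the dimension of the generic stalk is its
  -- value at every point.
  refine ⟨Module.finrank X.functionField (RatSec (cokernel j)),
    (isTorsionFree_cokernel_of_saturated hs k j hsj hrange hF
      hW.isTorsionFree).isLocallyFreeOfRank fun x => ?_⟩
  obtain ⟨a, c, w, U, hx, hU, hw⟩ := exists_adapted_local_basis hP hW s x
  have hsurj : Function.Surjective (ratLin (cokernel.π j)) := fun r => by
    obtain ⟨l, -, hl⟩ := exists_ratLin_eq_of_epi (cokernel.π j) (mem_regularAt_genericPoint r)
    exact ⟨l, hl⟩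
  let g : RatSec W →ₗ[X.functionField] (Fin c → X.functionField) :=
    LinearMap.pi fun k => Finsupp.lapply (Sum.inr k) ∘ₗ w.repr.toLinearMap
  have hg : ∀ r l, g r l = w.repr r (Sum.inr l) := fun _ _ => rfl
  have hlift : ∀ d : Fin c → X.functionField, g (∑ l, d l • w (Sum.inr l)) = d := by
    intro d
    have : ∑ l, d l • w (Sum.inr l) = ∑ l, (Sum.elim 0 d : _ → X.functionField) l • w l := by
      rw [Fintype.sum_sum_type]
      simp
    ext l
    rw [this, hg, w.repr_sum_self]
    rfl
  -- Both the quotient map and the last `c` coordinates have kernel `s(Rat F)`, so these coordinates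
  -- give a basis of the generic stalk of `W / K`.
  obtain ⟨e, he⟩ := exists_equiv_of_ker_eq (ratLin (cokernel.π j)) g hsurj
    (fun d => ⟨_, hlift d⟩) (fun r => by
      have h1 : g r = 0 ↔ r ∈ LinearMap.range s := by
        rw [hw, funext_iff]
        rfl
      rw [h1]
      constructor
      · intro h
        obtain ⟨l, rfl⟩ := exists_ratLin_eq_of_exact (ShortComplex.exact_cokernel j) r h
        exact ⟨_, hsj l⟩
      · rintro ⟨f, rfl⟩
        obtain ⟨l, rfl⟩ := (ratLin_bijective_of_saturated k hrange).2 f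
        rw [hsj]
        exact ratLin_comp_eq_zero (cokernel.condition j) l)
  let b := Module.Basis.ofEquivFun e
  have hb : ∀ r l, b.repr (ratLin (cokernel.π j) r) l = w.repr r (Sum.inr l) := fun r l =>
    congrFun (he r) l
  have hc : c = Module.finrank X.functionField (RatSec (cokernel j)) := by
    rw [Module.finrank_eq_card_basis b, Fintype.card_fin]
  refine ⟨b.reindex (finCongr hc), U, hx, fun y hy => IsLocalBasis.reindex (fun r => ?_) _⟩
  constructor
  · intro h l
    obtain ⟨r', hr', rfl⟩ := exists_ratLin_eq_of_epi (cokernel.π j) h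
    rw [hb]
    exact (hU y hy r').1 hr' _
  · intro h
    have h1 : ratLin (cokernel.π j) (∑ l, b.repr r l • w (Sum.inr l)) = r := by
      apply e.injective
      rw [he, hlift]
      rfl
    rw [← h1]
    exact ratLin_mem_regularAt _ (sum_mem fun l _ => smul_mem_regularAt (h l) ((hU y hy).mem _))

omit hs hsj in
theorem stalk_surjective_of_saturated {x : X}
    (h : ∀ f ∈ regularAt F x, s f ∈ regularAt W x) :
    Function.Surjective ((TopCat.Presheaf.stalkFunctor Ab x).map k.mapPresheaf).hom := by
  intro t
  obtain ⟨U, hx, f, rfl⟩ := F.presheaf.exists_germ_eq t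
  obtain ⟨V, hxV, hV⟩ := regularAt_open (h _ (toRat_mem_regularAt hx f))
  obtain ⟨m, hm⟩ := (hrange (U ⊓ V) (resSec F inf_le_left f)).2 fun y hy => by
    rw [toRat_resSec]
    exact hV y hy.2
  refine ⟨K.presheaf.germ (U ⊓ V) x ⟨hx, hxV⟩ m, ?_⟩
  refine (TopCat.Presheaf.stalkFunctor_map_germ_apply (U ⊓ V) x ⟨hx, hxV⟩ k.mapPresheaf m).trans ?_
  exact (congrArg _ hm).trans (TopCat.Presheaf.germ_res_apply' F.presheaf _ _ _ _)

end Saturated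

/-! ### The elementary transformation defined by a rational splitting -/

section Transformation

variable {X : Scheme.{0}} [IsIntegral X] {W F : X.Modules} {π : W ⟶ F} {s : RatHom F W}

/-- The subsheaf of `W` of sections that lie in the image of a rational map. -/
def saturatedData (s : RatHom F W) : SubsheafData W where
  obj U :=
    { carrier := {w | ∀ h : genericPoint X ∈ U, toRat W h w ∈ LinearMap.range s}
      add_mem' := fun ha hb h => by
        rw [map_add]
        exact add_mem (ha h) (hb h)
      zero_mem' := fun h => by
        rw [map_zero]
        exact zero_mem _
      smul_mem' := fun r a ha h => by
        rw [toRat_smul]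
        exact Submodule.smul_mem _ _ (ha h) }
  res U V h m hm hV := by
    rw [toRat_resSec]
    exact hm (h hV)
  loc U m hm hU := by
    obtain ⟨V, hVU, hV, h⟩ := hm _ hU
    rw [← toRat_resSec hVU hV]
    exact h hV

theorem mono_saturated (hs : ∀ f, ratLin π (s f) = f) (hW : IsTorsionFree W) :
    Mono ((saturatedData s).ι ≫ π) := by
  refine mono_of_appLin_injective _ fun U => ?_
  rw [injective_iff_map_eq_zero]
  intro m hm
  refine (saturatedData s).appLin_ι_injective U ?_
  rw [map_zero]
  by_cases hU : genericPoint X ∈ U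
  · obtain ⟨f, hf⟩ := m.2 hU
    change s f = toRat W hU (appLin (saturatedData s).ι U m) at hf
    refine hW U hU ?_
    rw [map_zero, ← hf]
    have : f = 0 := by
      rw [← hs f, hf, ratLin_toRat, ← appLin_comp, hm, map_zero]
    rw [this, map_zero]
  · have := subsingleton_sections (M := W) hU
    exact Subsingleton.elim _ _

theorem mem_range_saturated (hs : ∀ f, ratLin π (s f) = f) (hF : IsTorsionFree F)
    (hW : IsTorsionFree W) (U : X.Opens) (f : Γ(F, U)) :
    f ∈ LinearMap.range (appLin ((saturatedData s).ι ≫ π) U) ↔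
      ∀ (x : X) (hx : x ∈ U), s (toRat F (genericPoint_mem hx) f) ∈ regularAt W x := by
  constructor
  · rintro ⟨m, rfl⟩ x hx
    have hU := genericPoint_mem hx
    obtain ⟨f, hf⟩ := m.2 hU
    change s f = toRat W hU (appLin (saturatedData s).ι U m) at hf
    rw [appLin_comp, ← ratLin_toRat, ← hf, hs, hf]
    exact toRat_mem_regularAt hx _
  · intro h
    by_cases hU : genericPoint X ∈ U
    · obtain ⟨w, hw⟩ := hW.exists_toRat_eq hU (s (toRat F hU f)) h
      obtain ⟨m, rfl⟩ := ((saturatedData s).mem_range_appLin_ι U w).2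
        (fun _ => ⟨toRat F hU f, hw.symm⟩)
      refine ⟨m, hF U hU ?_⟩
      rw [appLin_comp, ← ratLin_toRat, hw, hs]
    · have := subsingleton_sections (M := F) hU
      exact ⟨0, Subsingleton.elim _ _⟩

/-- `K` is the image under `π` of the subsheaf `W ∩ s(Rat F)`, and the lifting is the inverse of
this identification. Principal stalks give the subbundle property; finiteness of proper closed sets
gives the finite support of `F / K`. -/
theorem exists_liftedElementaryTransformation
    (hP : ∀ x : X, IsPrincipalIdealRing (X.presheaf.stalk x))
    (hfin : ∀ U : X.Opens, genericPoint X ∈ U → (U : Set X)ᶜ.Finite) {n N : ℕ}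
    (hF : IsLocallyFreeOfRank F n) (hW : IsLocallyFreeOfRank W N)
    (hs : ∀ f, ratLin π (s f) = f) :
    ∃ t : LiftedElementaryTransformation π n,
      (∀ r, s (ratLin t.K.arrow r) = ratLin t.lift r) ∧
      ∀ (U : X.Opens) (f : Γ(F, U)), f ∈ LinearMap.range (appLin t.K.arrow U) ↔
        ∀ (x : X) (hx : x ∈ U), s (toRat F (genericPoint_mem hx) f) ∈ regularAt W x := by
  have := mono_saturated hs hW.isTorsionFree
  let k := (saturatedData s).ι ≫ π
  let K := Subobject.mk k
  let j : (K : X.Modules) ⟶ W := (Subobject.underlyingIso k).hom ≫ (saturatedData s).ι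
  have hj : j ≫ π = K.arrow := by
    rw [Category.assoc]
    exact Subobject.underlyingIso_hom_comp_eq_mk k
  have hrange : ∀ (U : X.Opens) (f : Γ(F, U)), f ∈ LinearMap.range (appLin K.arrow U) ↔
      ∀ (x : X) (hx : x ∈ U), s (toRat F (genericPoint_mem hx) f) ∈ regularAt W x := by
    intro U f
    rw [← mem_range_saturated hs hF.isTorsionFree hW.isTorsionFree]
    constructor
    · rintro ⟨m, rfl⟩
      refine ⟨appLin (Subobject.underlyingIso k).hom U m, ?_⟩
      rw [← appLin_comp, Subobject.underlyingIso_hom_comp_eq_mk]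
    · rintro ⟨m, rfl⟩
      obtain ⟨m', rfl⟩ := (appLin_bijective (Subobject.underlyingIso k).hom U).2 m
      refine ⟨m', ?_⟩
      rw [← appLin_comp, Subobject.underlyingIso_hom_comp_eq_mk]
  have hsj : ∀ r, s (ratLin K.arrow r) = ratLin j r := by
    intro r
    obtain ⟨U, -, hU, m, rfl⟩ := exists_toRat_eq (U := ⊤) trivial r
    obtain ⟨f, hf⟩ := (appLin (Subobject.underlyingIso k).hom U m).2 hU
    change s f = toRat W hU (appLin j U m) at hf
    rw [← hj, ratLin_comp, LinearMap.comp_apply, ratLin_toRat j, ← hf, hs]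
  have hmono : Mono j := mono_of_mono_fac hj
  -- `s` is regular at the generic point, hence on a nonempty open set `U`; there `K` and `F` have
  -- the same stalks.
  obtain ⟨U, hU, hUs⟩ := hF.preserves_open (x := genericPoint X) s
    (fun f _ => mem_regularAt_genericPoint _)
  exact ⟨{
    K := K
    isElementaryTransformation :=
      ⟨isLocallyFreeOfRank_of_saturated hs K.arrow j hsj hrange hP hF hW,
        (hfin U hU).subset fun x hx hxU => hx (stalk_surjective_of_saturated K.arrow hrange
          (hUs x hxU))⟩
    lift := j
    lift_comp := hj
    isSubbundle := ⟨hmono, isLocallyFreeOfRank_of_saturated hs K.arrow j hsj hrange hP hF hW,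
      isLocallyFree_cokernel_of_saturated hs K.arrow j hsj hrange hP hF.isTorsionFree hW⟩ },
    hsj, hrange⟩

/-- The lifting of an elementary transformation is the restriction of a rational splitting. -/
theorem LiftedElementaryTransformation.exists_splitting {n : ℕ} (hF : IsLocallyFreeOfRank F n)
    (t : LiftedElementaryTransformation π n) :
    Function.Bijective (ratLin t.K.arrow) ∧ ∃ s : RatHom F W, (∀ f, ratLin π (s f) = f) ∧
      ∀ r, s (ratLin t.K.arrow r) = ratLin t.lift r := by
  have hbij : Function.Bijective (ratLin t.K.arrow) := by
    obtain ⟨b, -⟩ := hF.exists_basis (genericPoint X)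
    obtain ⟨b', -⟩ := t.isElementaryTransformation.1.exists_basis (genericPoint X)
    have := Module.Finite.of_basis b
    have := Module.Finite.of_basis b'
    exact ⟨ratLin_injective _, (LinearMap.injective_iff_surjective_of_finrank_eq_finrank (by
      rw [hF.finrank_eq, t.isElementaryTransformation.1.finrank_eq])).1 (ratLin_injective _)⟩
  let e := LinearEquiv.ofBijective _ hbij
  have he : ∀ r, e.symm (ratLin t.K.arrow r) = r := e.symm_apply_apply
  refine ⟨hbij, ratLin t.lift ∘ₗ e.symm.toLinearMap, fun f => ?_, fun r => ?_⟩
  · obtain ⟨r, rfl⟩ := hbij.2 f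
    rw [LinearMap.comp_apply, LinearEquiv.coe_coe, he, ← LinearMap.comp_apply, ← ratLin_comp,
      t.lift_comp]
  · rw [LinearMap.comp_apply, LinearEquiv.coe_coe, he]

/-- The subbundle condition is used here: `W / K` is torsion-free, so a rational section of `K`
whose lift is regular in `W` is itself regular. -/
theorem LiftedElementaryTransformation.mem_range_iff {n : ℕ} (hF : IsLocallyFreeOfRank F n)
    (t : LiftedElementaryTransformation π n)
    (hsj : ∀ r, s (ratLin t.K.arrow r) = ratLin t.lift r) (U : X.Opens) (f : Γ(F, U)) :
    f ∈ LinearMap.range (appLin t.K.arrow U) ↔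
      ∀ (x : X) (hx : x ∈ U), s (toRat F (genericPoint_mem hx) f) ∈ regularAt W x := by
  have hmono : Mono t.lift := t.isSubbundle.1
  obtain ⟨r, hr⟩ := t.isSubbundle.2.2
  constructor
  · rintro ⟨m, rfl⟩ x hx
    rw [← ratLin_toRat, hsj, ratLin_toRat]
    exact toRat_mem_regularAt hx _
  · intro h
    by_cases hU : genericPoint X ∈ U
    · obtain ⟨k, hk⟩ := (t.exists_splitting hF).1.2 (toRat F hU f)
      obtain ⟨m, rfl⟩ := t.isElementaryTransformation.1.isTorsionFree.exists_toRat_eq hU k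
        (fun x hx => by
          rw [← ratLin_mem_regularAt_iff (ShortComplex.exact_cokernel t.lift) hr.isTorsionFree,
            ← hsj, hk]
          exact h x hx)
      refine ⟨m, hF.isTorsionFree U hU ?_⟩
      rw [← ratLin_toRat, hk]
    · have := subsingleton_sections (M := F) hU
      exact ⟨0, Subsingleton.elim _ _⟩

/-- A lifted elementary transformation is determined by its rational splitting. -/
theorem LiftedElementaryTransformation.eq_of_splitting {n : ℕ} (hF : IsLocallyFreeOfRank F n)
    (hW : IsTorsionFree W) (t t' : LiftedElementaryTransformation π n)
    (h : ∀ r, s (ratLin t.K.arrow r) = ratLin t.lift r)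
    (h' : ∀ r, s (ratLin t'.K.arrow r) = ratLin t'.lift r) : t = t' := by
  have hr : ∀ U, LinearMap.range (appLin t.K.arrow U) = LinearMap.range (appLin t'.K.arrow U) :=
    fun U => by
      ext f
      rw [t.mem_range_iff hF h, t'.mem_range_iff hF h']
  obtain ⟨l, hl⟩ := exists_fac_of_range_le t.K.arrow t'.K.arrow (fun U => (hr U).le)
  obtain ⟨l', hl'⟩ := exists_fac_of_range_le t'.K.arrow t.K.arrow (fun U => (hr U).ge)
  have hK : t.K = t'.K := le_antisymm (Subobject.le_of_comm l hl) (Subobject.le_of_comm l' hl')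
  obtain ⟨K, h1, j, h2, h3⟩ := t
  obtain ⟨K', h1', j', h2', h3'⟩ := t'
  dsimp only at hK
  subst hK
  have hj : j = j' := hom_eq_of_appLin_eq fun U m => by
    by_cases hU : genericPoint X ∈ U
    · refine hW U hU ?_
      rw [← ratLin_toRat, ← ratLin_toRat]
      exact (h _).symm.trans (h' _)
    · have := subsingleton_sections (M := W) hU
      exact Subsingleton.elim _ _
  subst hj
  rfl

end Transformation

/-! ### Principal parts and rational splittings -/

section Splittings

variable {X : Scheme.{0}} [IsIntegral X] {E W F : X.Modules} {i : E ⟶ W} {π : W ⟶ F}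
  {w : i ≫ π = 0} {m n : ℕ}

/-- The rational splitting `s` of `π` has the polar parts of `-i ∘ q`. -/
def IsSplittingOf (i : E ⟶ W) (π : W ⟶ F) (q : PrinHom F E) (s : RatHom F W) : Prop :=
  (∀ f, ratLin π (s f) = f) ∧
    ∀ (x : X) (b : RatHom F E), q.1 ⟨x, trivial⟩ = QuotientAddGroup.mk b →
      ∀ f ∈ regularAt F x, s f + ratLin i (b f) ∈ regularAt W x

theorem sub_mem_homRegularAt {x : X} {b b' : RatHom F E}
    (h : (QuotientAddGroup.mk b : RatHom F E ⧸ homRegularAt F E x) = QuotientAddGroup.mk b') :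
    b' - b ∈ homRegularAt F E x := by
  have := QuotientAddGroup.eq.1 h
  rwa [neg_add_eq_sub] at this

/-- Two representatives of `q` at `x` differ by a map regular at `x`, so testing one of them is
enough. -/
theorem IsSplittingOf.of_cover [Mono i] (hF : IsLocallyFreeOfRank F n) (hE : IsTorsionFree E)
    {q : PrinHom F E} {s : RatHom F W} (hs : ∀ f, ratLin π (s f) = f)
    (h : ∀ x : X, ∃ b : RatHom F E, q.1 ⟨x, trivial⟩ = QuotientAddGroup.mk b ∧
      ∀ f ∈ regularAt F x, s f + ratLin i (b f) ∈ regularAt W x) : IsSplittingOf i π q s := by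
  refine ⟨hs, fun x b hb f hf => ?_⟩
  obtain ⟨b', hb', h'⟩ := h x
  have h1 := (mem_homRegularAt_iff hF hE).1 (sub_mem_homRegularAt (hb'.symm.trans hb)) f hf
  have h2 := add_mem (h' f hf) (ratLin_mem_regularAt i h1)
  rwa [LinearMap.sub_apply, map_sub, add_assoc, add_sub_cancel] at h2

/-- The kernel of a principal part. -/
theorem IsSplittingOf.isKer_iff [Mono i] (hS : (ShortComplex.mk i π w).Exact)
    (hF : IsTorsionFree F) {q : PrinHom F E} {s : RatHom F W} (h : IsSplittingOf i π q s)
    (K : Subobject F)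
    (hK : ∀ (U : X.Opens) (f : Γ(F, U)), f ∈ LinearMap.range (appLin K.arrow U) ↔
      ∀ (x : X) (hx : x ∈ U), s (toRat F (genericPoint_mem hx) f) ∈ regularAt W x) :
    IsKer q K := by
  intro U
  ext f
  refine Iff.trans (hK U f) ?_
  rw [AddMonoidHom.mem_ker]
  have h1 : PrinHom.app q U f = 0 ↔ ∀ x : U, evalStalk F E x.1 (toRat F (genericPoint_mem x.2) f)
      (toRat_mem_regularAt x.2 f) (q.1 ⟨x.1, trivial⟩) = 0 := by
    rw [Subtype.ext_iff, funext_iff]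
    rfl
  rw [h1, Subtype.forall]
  refine forall₂_congr fun x hx => ?_
  obtain ⟨b, hb⟩ := QuotientAddGroup.mk_surjective (q.1 ⟨x, trivial⟩)
  -- Since `s f + i (b f)` is regular at `x`, `s f` is regular there if and only if `i (b f)` is,
  -- which means that `b f` is.
  have h2 := h.2 x b hb.symm _ (toRat_mem_regularAt hx f)
  have h3 : evalStalk F E x (toRat F (genericPoint_mem hx) f) (toRat_mem_regularAt hx f)
      (q.1 ⟨x, trivial⟩) = QuotientAddGroup.mk (b (toRat F (genericPoint_mem hx) f)) := by
    rw [← hb]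
    rfl
  rw [h3, QuotientAddGroup.eq_zero_iff, ← ratLin_mem_regularAt_iff hS hF]
  constructor
  · intro h4
    have := sub_mem h2 h4
    rwa [add_sub_cancel_left] at this
  · intro h4
    have := sub_mem h2 h4
    rwa [add_sub_cancel_right] at this

/-- The map `s` of a lifting is automatically a splitting of `π`, since `lift ≫ π` is the inclusion
of `K` and `Rat(K) = Rat(F)`. -/
theorem isLiftOf_iff (hF : IsLocallyFreeOfRank F n) (hW : IsTorsionFree W) (q : PrinHom F E)
    (t : LiftedElementaryTransformation π n) :
    IsLiftOf i q t ↔ ∃ s, IsSplittingOf i π q s ∧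
      ∀ r, s (ratLin t.K.arrow r) = ratLin t.lift r := by
  have hreg : ∀ (s : RatHom F W) (x : X) (b : RatHom F E),
      (∃ ρ ∈ homRegularAt F W x, ∀ f : RatSec F, ρ f = s f + ratMap i (b f)) ↔
        ∀ f ∈ regularAt F x, s f + ratLin i (b f) ∈ regularAt W x := by
    intro s x b
    constructor
    · rintro ⟨ρ, hρ, h⟩ f hf
      have := (mem_homRegularAt_iff hF hW).1 hρ f hf
      rwa [h] at this
    · intro h
      exact ⟨s + ratLin i ∘ₗ b, (mem_homRegularAt_iff hF hW).2 h, fun f => rfl⟩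
  constructor
  · rintro ⟨s, h1, h2⟩
    have hst : ∀ r, s (ratLin t.K.arrow r) = ratLin t.lift r := by
      intro r
      obtain ⟨U, -, hU, k, rfl⟩ := exists_toRat_eq (U := ⊤) trivial r
      rw [ratLin_toRat, ratLin_toRat]
      exact (h1 U hU k).symm
    refine ⟨s, ⟨fun f => ?_, fun x b hb => (hreg s x b).1 (h2 x b hb)⟩, hst⟩
    obtain ⟨r, rfl⟩ := (t.exists_splitting hF).1.2 f
    rw [hst, ← LinearMap.comp_apply, ← ratLin_comp, t.lift_comp]
  · rintro ⟨s, h1, h2⟩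
    refine ⟨s, fun U hU k => ?_, fun x b hb => (hreg s x b).2 (h1.2 x b hb)⟩
    have := h2 (toRat _ hU k)
    rw [ratLin_toRat, ratLin_toRat] at this
    exact this.symm

/-- If `Hom(F, E)` has no global sections, the splitting is determined by the principal part. -/
theorem IsSplittingOf.eq_right [Mono i] (hS : (ShortComplex.mk i π w).Exact)
    (hE : IsTorsionFree E) (hF : IsTorsionFree F) (h0 : Subsingleton (HomSections F E ⊤))
    {q : PrinHom F E} {s s' : RatHom F W} (h : IsSplittingOf i π q s)
    (h' : IsSplittingOf i π q s') : s = s' := by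
  -- The difference of two splittings is `i ∘ β`. Both have the polar parts of `-i ∘ q`, so `β` is
  -- regular everywhere and vanishes.
  obtain ⟨β, hβ⟩ := exists_lift_of_exact hS (s - s') (fun r => by
    rw [LinearMap.sub_apply, map_sub, h.1, h'.1, sub_self])
  have : β = 0 := hE.eq_zero_of_regular h0 β fun x f hf => by
    rw [← ratLin_mem_regularAt_iff hS hF, hβ]
    obtain ⟨b, hb⟩ := QuotientAddGroup.mk_surjective (q.1 ⟨x, trivial⟩)
    have := sub_mem (h.2 x b hb.symm f hf) (h'.2 x b hb.symm f hf)
    rwa [add_sub_add_right_eq_sub] at this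
  rw [← sub_eq_zero]
  ext r
  rw [← hβ, this, LinearMap.zero_apply, map_zero, LinearMap.zero_apply]

/-- The principal part is determined by the splitting. -/
theorem IsSplittingOf.eq_left [Mono i] (hS : (ShortComplex.mk i π w).Exact)
    (hE : IsTorsionFree E) (hF : IsLocallyFreeOfRank F n) {q q' : PrinHom F E} {s : RatHom F W}
    (h : IsSplittingOf i π q s) (h' : IsSplittingOf i π q' s) : q = q' := by
  refine Subtype.ext (funext fun x => ?_)
  obtain ⟨b, hb⟩ := QuotientAddGroup.mk_surjective (q.1 x)
  obtain ⟨b', hb'⟩ := QuotientAddGroup.mk_surjective (q'.1 x)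
  rw [← hb, ← hb', QuotientAddGroup.eq, mem_homRegularAt_iff hF hE]
  intro f hf
  rw [← ratLin_mem_regularAt_iff hS hF.isTorsionFree, neg_add_eq_sub, LinearMap.sub_apply, map_sub]
  have := sub_mem (h'.2 x.1 b' hb'.symm f hf) (h.2 x.1 b hb.symm f hf)
  rwa [add_sub_add_left_eq_sub] at this

/-- A principal part that represents the class of the extension defines a rational splitting. -/
theorem RepresentsExtension.exists_splitting [Mono i] (hF : IsLocallyFreeOfRank F n)
    (hE : IsTorsionFree E) (w : i ≫ π = 0) {q : PrinHom F E} (h : RepresentsExtension i π q) :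
    ∃ s, IsSplittingOf i π q s := by
  obtain ⟨δ, ⟨c, hc, σ, hσπ, hσc⟩, ⟨c', hc', b, hbq, hbc⟩⟩ := h
  obtain ⟨V, hV, hVc, hVc', γ, hγ⟩ : c.Cohomologous c' := _root_.Quotient.exact (hc.symm.trans hc')
  have hη : ∀ x, genericPoint X ∈ V x := fun x => genericPoint_mem (hV x)
  choose σR hσR using fun x => HomSections.exists_induces (σ x) (hVc x (hη x))
  choose γR hγR using fun x => HomSections.exists_induces (γ x) (hη x)
  -- The cohomology relation reads `(b_y - b_x) - τ = γ_y - γ_x` with `i ∘ τ = σ_y - σ_x`;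
  -- rearranged, it says that `S x = S y`.
  let S : X → RatHom F W := fun x => σR x + ratLin i ∘ₗ γR x - ratLin i ∘ₗ b x
  have hS : ∀ x f, S x f = σR x f + ratLin i (γR x f) - ratLin i (b x f) := fun _ _ => rfl
  have hσπR : ∀ x f, ratLin π (σR x f) = f := by
    intro x r
    obtain ⟨U, hU, hUη, f, rfl⟩ := exists_toRat_eq (hVc x (hη x)) r
    rw [← hσR x ⟨U, hU⟩ hUη f, ratLin_toRat]
    exact congrArg _ (hσπ x ⟨U, hU⟩ f)
  have hSS : ∀ x y, S x = S y := by
    intro x y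
    have hxy : genericPoint X ∈ V x ⊓ V y := ⟨hη x, hη y⟩
    have hcxy : genericPoint X ∈ c.U x ⊓ c.U y := ⟨hVc x (hη x), hVc y (hη y)⟩
    obtain ⟨τ, hτ⟩ := HomSections.exists_induces (c.c x y) hcxy
    have h1 : ∀ r, ratLin i (τ r) = σR y r - σR x r := by
      intro r
      obtain ⟨U, hU, hUη, f, rfl⟩ := exists_toRat_eq hcxy r
      rw [← hτ ⟨U, hU⟩ hUη f, ratLin_toRat, ← hσR y ⟨U, hU.trans inf_le_right⟩ hUη f,
        ← hσR x ⟨U, hU.trans inf_le_left⟩ hUη f, ← map_sub]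
      exact congrArg _ (hσc x y ⟨U, hU⟩ f)
    have h2 := ((hbc x y).res (inf_le_inf (hVc' x) (hVc' y))).sub
      (hτ.res (inf_le_inf (hVc x) (hVc y)))
    rw [hγ x y] at h2
    have h3 := h2.eq_right hxy (((hγR y).res inf_le_right).sub ((hγR x).res inf_le_left))
    ext r
    have h4 := congrArg (ratLin i) (LinearMap.congr_fun h3 r)
    simp only [LinearMap.sub_apply, map_sub, h1] at h4
    rw [hS, hS]
    rw [← sub_eq_zero] at h4 ⊢
    rw [← h4]
    abel
  -- Any base point would do, by `hSS`.
  refine ⟨S (genericPoint X), IsSplittingOf.of_cover hF hE (fun f => ?_) fun x =>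
    ⟨b x, hbq x x (c'.mem_U x), fun f hf => ?_⟩⟩
  · rw [hS, map_sub, map_add, hσπR, ratLin_comp_eq_zero w, ratLin_comp_eq_zero w, add_zero, sub_zero]
  · rw [hSS _ x, hS, sub_add_cancel]
    exact add_mem ((hσR x).mem (hVc x (hV x)) hf)
      (ratLin_mem_regularAt i ((hγR x).mem (hV x) hf))

/-- A rational splitting defines a principal part that represents the class of the extension. -/
theorem exists_principalPart [Mono i] [Epi π] (hS : (ShortComplex.mk i π w).Exact)
    (hE : IsTorsionFree E) (hF : IsLocallyFreeOfRank F n) {s : RatHom F W}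
    (hs : ∀ f, ratLin π (s f) = f) :
    ∃ q : PrinHom F E, RepresentsExtension i π q ∧ IsSplittingOf i π q s := by
  have hW := isTorsionFree_of_exact hS hE hF.isTorsionFree
  choose σ hσ U hU hσU using fun x => exists_local_splitting (p := π) hF x
  choose β hβ using fun x => exists_lift_of_exact hS (σ x - s) (fun r => by
    rw [LinearMap.sub_apply, map_sub, hσ, hs, sub_self])
  have hβ' : ∀ x y r, ratLin i ((β y - β x) r) = σ y r - σ x r := by
    intro x y r
    rw [LinearMap.sub_apply, map_sub, hβ, hβ, LinearMap.sub_apply, LinearMap.sub_apply,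
      sub_sub_sub_cancel_right]
  have hreg : ∀ x y z, z ∈ U x ⊓ U y → ∀ f ∈ regularAt F z, (β y - β x) f ∈ regularAt E z := by
    intro x y z hz f hf
    rw [← ratLin_mem_regularAt_iff hS hF.isTorsionFree, hβ']
    exact sub_mem (hσU y z hz.2 f hf) (hσU x z hz.1 f hf)
  have hmk : ∀ x, ∀ y ∈ U x, (QuotientAddGroup.mk (β y) : RatHom F E ⧸ homRegularAt F E y) =
      QuotientAddGroup.mk (β x) := by
    intro x y hy
    rw [QuotientAddGroup.eq, neg_add_eq_sub, mem_homRegularAt_iff hF hE]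
    exact hreg y x y ⟨hU y, hy⟩
  let q : PrinHom F E := ⟨fun x => QuotientAddGroup.mk (β x.1), fun x =>
    ⟨U x.1, hU x.1, β x.1, fun y hy => hmk x.1 y.1 hy⟩⟩
  choose c hc using fun x y => hE.exists_induces (U := U x ⊓ U y) (β y - β x) (hreg x y)
  choose φ hφ using fun x => hW.exists_induces (U := U x) (σ x) (hσU x)
  -- One cocycle serves for both classes: it is the difference of the `β` and, after `i`, the
  -- difference of the local splittings `φ`.
  let C : HomCocycle F E :=
    { U := U
      mem_U := hU
      c := c
      cocycle := fun x y z => by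
        refine Induces.eq_left hE (β := β z - β x) ?_ ((hc x z).res _)
        have := ((hc x y).res (inf_le_left : U x ⊓ U y ⊓ U z ≤ _)).add
          ((hc y z).res (inf_le_inf_right (U z) (inf_le_right : U x ⊓ U y ≤ U y)))
        rwa [sub_add_sub_cancel'] at this }
  refine ⟨q, ⟨_, ⟨C, rfl, φ, fun x V f => ?_, fun x y V f => ?_⟩, C, rfl, β, hmk, hc⟩,
    IsSplittingOf.of_cover hF hE hs fun x => ⟨β x, rfl, fun f hf => ?_⟩⟩
  · by_cases hV : genericPoint X ∈ V.1
    · refine hF.isTorsionFree V.1 hV ?_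
      refine (ratLin_toRat π hV _).symm.trans ?_
      rw [hφ x V hV, hσ]
    · have := subsingleton_sections (M := F) hV
      exact Subsingleton.elim _ _
  · by_cases hV : genericPoint X ∈ V.1
    · refine hW V.1 hV ?_
      refine (ratLin_toRat i hV _).symm.trans ?_
      rw [map_sub, hφ y ⟨V.1, _⟩ hV, hφ x ⟨V.1, _⟩ hV, ← hβ']
      exact congrArg _ (hc x y V hV f)
    · have := subsingleton_sections (M := W) hV
      exact Subsingleton.elim _ _
  · rw [hβ, LinearMap.sub_apply, add_sub_cancel]
    exact hσU x x (hU x) f hf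

end Splittings
end CurveExt

end

/-! ### The correspondence -/

open CurveExt

theorem corollary6 (X : Scheme.{0}) [IsIntegral X] (f : X ⟶ Spec (CommRingCat.of ℂ)) [IsProper f]
    [SmoothOfRelativeDimension 1 f] (m n : ℕ) (E W F : X.Modules)
    (hE : IsLocallyFreeOfRank E m) (hF : IsLocallyFreeOfRank F n)
    (i : E ⟶ W) (π : W ⟶ F) (w : i ≫ π = 0) (hW : (ShortComplex.mk i π w).ShortExact)
    (h0 : Subsingleton (HomSections F E ⊤)) :
    ∃ Φ : {q : PrinHom F E // RepresentsExtension i π q} ≃ LiftedElementaryTransformation π n,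
      ∀ q, IsKer q.1 (Φ q).K ∧ IsLiftOf i q.1 (Φ q) := by
  have : Mono i := hW.mono_f
  have : Epi π := hW.epi_g
  have hS := hW.exact
  have hWF := isLocallyFreeOfRank_of_exact hS hE hF
  have hEt := hE.isTorsionFree
  have hFt := hF.isTorsionFree
  have hWt := hWF.isTorsionFree
  have hexists : ∀ q : {q : PrinHom F E // RepresentsExtension i π q},
      ∃ t : LiftedElementaryTransformation π n, IsKer q.1 t.K ∧ IsLiftOf i q.1 t := by
    intro q
    obtain ⟨s, hs⟩ := q.2.exists_splitting hF hEt w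
    obtain ⟨t, h1, h2⟩ := exists_liftedElementaryTransformation (isPrincipalIdealRing_stalk f)
      (finite_compl f) hF hWF hs.1
    exact ⟨t, hs.isKer_iff hS hFt t.K h2, (isLiftOf_iff hF hWt q.1 t).2 ⟨s, hs, h1⟩⟩
  choose Φ hΦ using hexists
  refine ⟨Equiv.ofBijective Φ ⟨fun q q' h => ?_, fun t => ?_⟩, hΦ⟩
  · obtain ⟨s, hs, h1⟩ := (isLiftOf_iff hF hWt q.1 (Φ q)).1 (hΦ q).2
    obtain ⟨s', hs', h1'⟩ := (isLiftOf_iff hF hWt q'.1 (Φ q')).1 (hΦ q').2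
    rw [← h] at h1'
    -- Both splittings restrict to the same lifting on `K`, and `Rat(K) = Rat(F)`.
    have hss : s = s' := by
      ext r
      obtain ⟨k, rfl⟩ := ((Φ q).exists_splitting hF).1.2 r
      rw [h1, h1']
    subst hss
    exact Subtype.ext (hs.eq_left hS hEt hF hs')
  · obtain ⟨-, s, hs, h1⟩ := t.exists_splitting hF
    obtain ⟨q, hq, hqs⟩ := exists_principalPart hS hEt hF hs
    refine ⟨⟨q, hq⟩, ?_⟩
    obtain ⟨s', hs', h1'⟩ := (isLiftOf_iff hF hWt q (Φ ⟨q, hq⟩)).1 (hΦ ⟨q, hq⟩).2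
    -- The splitting of `t` and that of `Φ q` have the same principal part `q`; without global
    -- sections of `Hom(F, E)` they coincide.
    have hss := hqs.eq_right hS hEt hFt h0 hs'
    subst hss
    exact LiftedElementaryTransformation.eq_of_splitting hF hWt _ _ h1' h1
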